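/- **Setting.** Let $x\cdot y$ be the Minkowski product of signature $(1,-1,-1)$ on $\mathbb R^3$, let $(J_a)_{bc}=-\epsilon_{abc}$, $a=0,1,2$ ($\epsilon_{012}=1$), be the generators of $so(2,1)$, and identify $\mathbb R^3\cong so(2,1)$ by $p\cong p^aJ_a$. Let $L$ be the proper orthochronous Lorentz group of $\mathbb R^3$, acting on $\mathbb R^3$ by $\mathrm{Ad}$, and let $P=L\ltimes\mathbb R^3$ be the Poincaré group, with elements $(u,a)=(u,-\mathrm{Ad}(u)j)$. With a formal parameter $\theta$, $\theta^2=0$, identify $(u,a)$ with the matrix $(1+\theta a^bJ_b)u$ over $\mathbb R[\theta]$. An element $(u,-\mathrm{Ad}(u)j)$ is called hyperbolic if $u=e^{-p^aJ_a}$ with $p\cdot p<0$ ($p$ is then unique, and $(u,-\mathrm{Ad}(u)j)=e^{-(p^a+\theta k^a)J_a}$ for a unique $k$). Its mass $m$ and spin $s$ are given by $m>0$, $m^2=-p\cdot p$, $ms=p\cdot j$, and $\hat p=p/m$. Let $a_1,b_1,\dots,a_g,b_g$ be the standard free generators of the fundamental group of the genus $g$ surface $S_g$ with a disc removed, $h_i=b_ia_i^{-1}b_i^{-1}a_i$,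 and $$n_{a_i}=h_1^{-1}\cdots h_i^{-1}\,b_i\,h_{i-1}\cdots h_1,\qquad n_{b_i}=h_1^{-1}\cdots h_i^{-1}\,a_i\,h_{i-1}\cdots h_1 .$$ A point of $P^{2g}$ is a family of holonomies $A_i=(u_{A_i},-\mathrm{Ad}(u_{A_i})j_{A_i})$, $B_i=(u_{B_i},-\mathrm{Ad}(u_{B_i})j_{B_i})$; it assigns a holonomy $H_\eta$ to every $\eta$, and $m_\eta,s_\eta,p_\eta,k_\eta$ denote the quantities above for $H_\eta$. The Poisson bracket on $P^{2g}$ is that of the symplectic form $\Omega=\delta\Theta$, in the convention $\{F,G\}=dG(V_F)$, $\Omega(V_F,\cdot)=dF$, where with $u_{H_i}=u_{B_i}u_{A_i}^{-1}u_{B_i}^{-1}u_{A_i}$, $W_i=u_{H_{i-1}}\cdots u_{H_1}$, $W_i'=u_{A_i}^{-1}u_{B_i}^{-1}u_{A_i}W_i$, $W_i''=u_{B_i}^{-1}u_{A_i}W_i$ and $\langle j,\omega^aJ_a\rangle=j\cdot\omega$, $$\Theta=\sum_{i=1}^g\langle j_{A_i},\delta W_i\,W_i^{-1}-\delta W_i'\,W_i'^{-1}\rangle+\langle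 j_{B_i},\delta W_i'\,W_i'^{-1}-\delta W_i''\,W_i''^{-1}\rangle .$$ **Intersection points.** Let $\lambda=z_t^{\delta_t}\cdots z_1^{\delta_1}$ and $\eta=y_s^{\beta_s}\cdots y_1^{\beta_1}$ be closed curves written as words in the $a_i,b_i$ ($\delta_k,\beta_l=\pm1$), with $H_\lambda=Z_t^{\delta_t}\cdots Z_1^{\delta_1}$, $H_\eta=Y_s^{\beta_s}\cdots Y_1^{\beta_1}$. Draw them as follows. The starting points $s_x$ and endpoints $t_x$ of the generators are ordered from right to left as $$s_{a_1}<s_{b_1}<t_{a_1}<t_{b_1}<s_{a_2}<s_{b_2}<t_{a_2}<t_{b_2}<\cdots ;$$ each letter of $\lambda$ and $\eta$ is a strand parallel to its generator (strands of the same generator do not cross, and strands leave the line upwards); the strands of $\eta$ are joined along a horizontal line at the disc, and consecutive strands of $\lambda$ (cyclically, $z_{t+1}=z_1$) by horizontal segments, at distinct heights, slightly above that line. The intersection points $q_1,\dots,q_n$, in their order along $\eta$, all lie on these segments of $\lambda$. Let $q_i$ lie on the segment from $z_{k_i}^{\delta_{k_i}}$ to $z_{k_i+1}^{\delta_{k_i+1}}$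 and between $y_{l_i}^{\beta_{l_i}}$ and $y_{l_i+1}^{\beta_{l_i+1}}$ on $\eta$ ($0\le l_i\le s$), with oriented intersection number $\epsilon_i=1$ if $\lambda$ crosses $\eta$ from the left to the right in the direction of $\eta$, and $\epsilon_i=-1$ otherwise. Put $\zeta_i=Z_{k_i}^{\delta_{k_i}}\cdots Z_1^{\delta_1}$. **Transformations.** Let $H_\lambda$ be hyperbolic. * For $\tau\in\mathbb R[\theta]$, $D_{\tau\lambda}(H_\eta)$ is obtained from the product $Y_s^{\beta_s}\cdots Y_1^{\beta_1}$ by inserting at each $q_i$, between the $l_i$-th and the $(l_i+1)$-st factor and in the order of the $q_i$ along $\eta$, the element $\zeta_i\,e^{-\tau\epsilon_i(p_\lambda^a+\theta k_\lambda^a)J_a}\,\zeta_i^{-1}$. (For simple $\lambda$ and $\tau=t\in\mathbb R$ this is the infinitesimal Dehn twist action.) * $\widetilde{Gr}_{t\lambda}(H_\eta)$ is obtained by inserting instead $\zeta_i\,(1,-t\epsilon_ip_\lambda)\,\zeta_i^{-1}$, where $(1,-t\epsilon_ip_\lambda)=e^{-\theta t\epsilon_ip_\lambda^aJ_a}$.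 * Write also $\lambda=n_{x_r}^{\alpha_r}\cdots n_{x_1}^{\alpha_1}$, $\alpha_k=\pm1$. For $v_0\in L$ let $v_{A_i},v_{B_i}$ be the Lorentz parts of the holonomies of $n_{a_i},n_{b_i}$, conjugated by $v_0$ (that is, $v=v_0uv_0^{-1}$), $v_{H_i}=v_{B_i}v_{A_i}^{-1}v_{B_i}^{-1}v_{A_i}$, and $n=-\mathrm{Ad}(v_0)\hat p_\lambda$. The grafting map $Gr_{w\lambda}$ fixes all $u_{A_i},u_{B_i}$ and acts by $$j_{A_i}\mapsto j_{A_i}+w\,\mathrm{Ad}(v_0^{-1}v_{H_1}^{-1}\cdots v_{H_{i-1}}^{-1})\,\Sigma_{a_i},\qquad j_{B_i}\mapsto j_{B_i}-w\,\mathrm{Ad}(v_0^{-1}v_{H_1}^{-1}\cdots v_{H_{i-1}}^{-1}v_{A_i}^{-1}v_{B_i})\,\Sigma_{b_i},$$ $$\Sigma_{y}=\sum_{k:\,x_k=y,\ \alpha_k=1}\mathrm{Ad}(v_{X_{k-1}}^{\alpha_{k-1}}\cdots v_{X_1}^{\alpha_1})n-\sum_{k:\,x_k=y,\ \alpha_k=-1}\mathrm{Ad}(v_{X_k}^{\alpha_k}\cdots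 v_{X_1}^{\alpha_1})n .$$ **Theorem.** Let $\lambda,\eta$ be closed curves as above (in particular, $\lambda$ may be any closed simple curve), drawn in any way as described, and let $H_\lambda$ be hyperbolic. Then for all $w\in\mathbb R$ and $v_0\in L$ $$Gr_{wm_\lambda\lambda}=\widetilde{Gr}_{w\lambda}=D_{\theta w\lambda},$$ i.e. the three transformations map $H_\eta$ to the same element. If $H_\eta$ is hyperbolic as well, then $\Omega$ is nondegenerate at the point considered and there $$\{m_\lambda,s_\eta\}=\{s_\lambda,m_\eta\}=-\sum_{i=1}^n\epsilon_i\,\bigl(\mathrm{Ad}(u_{Z_{k_i}}^{\delta_{k_i}}\cdots u_{Z_1}^{\delta_1})\hat p_\lambda\bigr)\cdot\bigl(\mathrm{Ad}(u_{Y_{l_i}}^{\beta_{l_i}}\cdots u_{Y_1}^{\beta_1})\hat p_\eta\bigr).$$ -/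

import Mathlib

open scoped Matrix

noncomputable section

namespace Grafting

/-! ### Minkowski space and the Lorentz group -/

/-- The diagonal entries of the Minkowski metric `η = diag(1,-1,-1)`. -/
def sgn : Fin 3 → ℤ := ![1, -1, -1]

/-- The Minkowski product `x · y`. -/
def mink (x y : Fin 3 → ℝ) : ℝ := ∑ a, (sgn a : ℝ) * x a * y a

/-- The matrix of the Minkowski metric. -/
def etaMat : Matrix (Fin 3) (Fin 3) ℝ := Matrix.diagonal fun a => (sgn a : ℝ)

/-- The totally antisymmetric symbol with lower indices, `ε_{012} = 1`. -/
def lc (a b c : Fin 3) : ℤ :=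
  (((b : ℕ) : ℤ) - ((a : ℕ) : ℤ)) * (((c : ℕ) : ℤ) - ((a : ℕ) : ℤ)) *
    (((c : ℕ) : ℤ) - ((b : ℕ) : ℤ)) / 2

/-- The generator `J_a` of `so(2,1)`, `(J_a)_{bc} = - ε_{abc}`, as an endomorphism: the first index
is raised with `η`, so that `(J_a)^b_c = - η^{bb} ε_{abc}`. -/
def J (R : Type*) [CommRing R] (a : Fin 3) : Matrix (Fin 3) (Fin 3) R :=
  Matrix.of fun b c => ((-(sgn b * lc a b c) : ℤ) : R)

/-- `q^a J_a`, for a vector `q` with coefficients in `R` (`R = ℝ`, or `R = ℝ[θ]` with `θ² = 0`). -/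
def gen {R : Type*} [CommRing R] (q : Fin 3 → R) : Matrix (Fin 3) (Fin 3) R :=
  ∑ a, q a • J R a

lemma row_form {u : Matrix (Fin 3) (Fin 3) ℝ} (h : uᵀ * etaMat * u = etaMat) :
    u * etaMat * uᵀ = etaMat := by
  have e2 : etaMat * etaMat = 1 := by
    ext i j
    fin_cases i <;> fin_cases j <;> simp [etaMat, sgn]
  have h1 : (etaMat * uᵀ * etaMat) * u = 1 := by
    rw [Matrix.mul_assoc, Matrix.mul_assoc, ← Matrix.mul_assoc uᵀ, h, e2]
  have h2 : u * (etaMat * uᵀ * etaMat) = 1 := mul_eq_one_comm.mp h1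
  calc u * etaMat * uᵀ = u * (etaMat * uᵀ * etaMat) * etaMat := by
        simp only [Matrix.mul_assoc, e2, Matrix.mul_one]
    _ = etaMat := by rw [h2, Matrix.one_mul]

lemma col_zero {u : Matrix (Fin 3) (Fin 3) ℝ} (h : uᵀ * etaMat * u = etaMat) :
    u 0 0 ^ 2 = 1 + u 1 0 ^ 2 + u 2 0 ^ 2 := by
  have h0 := congrFun (congrFun h 0) 0
  simp [etaMat, Matrix.mul_apply, Fin.sum_univ_three, Matrix.diagonal_apply, sgn] at h0
  linarith

lemma row_zero {u : Matrix (Fin 3) (Fin 3) ℝ} (h : uᵀ * etaMat * u = etaMat) :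
    u 0 0 ^ 2 = 1 + u 0 1 ^ 2 + u 0 2 ^ 2 := by
  have h0 := congrFun (congrFun (row_form h) 0) 0
  simp [etaMat, Matrix.mul_apply, Fin.sum_univ_three, Matrix.diagonal_apply, sgn] at h0
  linarith

lemma mul_form {u v : Matrix (Fin 3) (Fin 3) ℝ} (hu : uᵀ * etaMat * u = etaMat)
    (hv : vᵀ * etaMat * v = etaMat) : (u * v)ᵀ * etaMat * (u * v) = etaMat := by
  calc (u * v)ᵀ * etaMat * (u * v) = vᵀ * (uᵀ * etaMat * u) * v := by
        simp only [Matrix.transpose_mul, Matrix.mul_assoc]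
    _ = etaMat := by rw [hu, hv]

lemma mul_zero_zero_pos {u v : Matrix (Fin 3) (Fin 3) ℝ} (hu : uᵀ * etaMat * u = etaMat)
    (hv : vᵀ * etaMat * v = etaMat) (h : 0 < u 0 0 * v 0 0) : 0 < (u * v) 0 0 := by
  have h1 := row_zero hu
  have h2 := col_zero hv
  rw [Matrix.mul_apply, Fin.sum_univ_three]
  have key : (u 0 1 * v 1 0 + u 0 2 * v 2 0) ^ 2 < (u 0 0 * v 0 0) ^ 2 := by
    rw [mul_pow, h1, h2]
    nlinarith [sq_nonneg (u 0 1 * v 2 0 - u 0 2 * v 1 0), sq_nonneg (u 0 1), sq_nonneg (u 0 2),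
      sq_nonneg (v 1 0), sq_nonneg (v 2 0)]
  have := (abs_lt_of_sq_lt_sq' key h.le).1
  linarith

/-- The proper orthochronous Lorentz group `L₃↑` in 2+1 dimensions. -/
def L3 : Subgroup (Matrix.SpecialLinearGroup (Fin 3) ℝ) where
  carrier := {u | u.1ᵀ * etaMat * u.1 = etaMat ∧ 0 < u.1 0 0}
  one_mem' := by simp
  mul_mem' := by
    rintro u v ⟨hu, hu0⟩ ⟨hv, hv0⟩
    exact ⟨mul_form hu hv, mul_zero_zero_pos hu hv (mul_pos hu0 hv0)⟩
  inv_mem' := by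
    rintro u ⟨hu, hu0⟩
    have hui : u.1 * (u⁻¹).1 = 1 := congrArg Subtype.val (mul_inv_cancel u)
    have hti : (u⁻¹).1ᵀ * u.1ᵀ = 1 := by
      rw [← Matrix.transpose_mul, hui, Matrix.transpose_one]
    have hv : (u⁻¹).1ᵀ * etaMat * (u⁻¹).1 = etaMat := by
      calc (u⁻¹).1ᵀ * etaMat * (u⁻¹).1
          = (u⁻¹).1ᵀ * (u.1ᵀ * etaMat * u.1) * (u⁻¹).1 := by rw [hu]
        _ = ((u⁻¹).1ᵀ * u.1ᵀ) * etaMat * (u.1 * (u⁻¹).1) := by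
            simp only [Matrix.mul_assoc]
        _ = etaMat := by rw [hti, hui, Matrix.one_mul, Matrix.mul_one]
    refine ⟨hv, ?_⟩
    have h2 := row_form hu
    have h3 : etaMat * (u⁻¹).1ᵀ = u.1 * etaMat := by
      calc etaMat * (u⁻¹).1ᵀ = (u.1 * etaMat * u.1ᵀ) * (u⁻¹).1ᵀ := by rw [h2]
        _ = u.1 * etaMat * ((u⁻¹).1 * u.1)ᵀ := by
            rw [Matrix.mul_assoc, Matrix.transpose_mul]
        _ = u.1 * etaMat := by
            rw [show (u⁻¹).1 * u.1 = 1 from congrArg Subtype.val (inv_mul_cancel u)]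
            simp
    have h4 := congrFun (congrFun h3 0) 0
    simp [etaMat, sgn] at h4
    have h5 : (u⁻¹).1 0 0 = u.1 0 0 := by simpa using h4
    change 0 < (u⁻¹).1 0 0
    rw [h5]
    exact hu0

/-- The matrix of a Lorentz transformation. -/
def lorMat (u : L3) : Matrix (Fin 3) (Fin 3) ℝ := u.1.1

/-- The adjoint action `Ad(u) x`; under `ℝ³ ≅ so(2,1)` it is the matrix action of `u`. -/
def Ad (u : L3) (x : Fin 3 → ℝ) : Fin 3 → ℝ := lorMat u *ᵥ x

lemma exp_form (p : Fin 3 → ℝ) :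
    (NormedSpace.exp (gen p))ᵀ * etaMat * NormedSpace.exp (gen p) = etaMat := by
  have e2 : etaMat * etaMat = 1 := by
    ext i j
    fin_cases i <;> fin_cases j <;> simp [etaMat, sgn]
  have hE : IsUnit etaMat := IsUnit.of_mul_eq_one _ e2
  have hEi : etaMat⁻¹ = etaMat := Matrix.inv_eq_left_inv e2
  have hA : (gen p)ᵀ = etaMat * (-gen p) * etaMat⁻¹ := by
    rw [hEi]
    ext i j
    fin_cases i <;> fin_cases j <;>
      simp [etaMat, sgn, gen, J, lc, Fin.sum_univ_three]
  rw [← Matrix.exp_transpose, hA, Matrix.exp_conj _ _ hE, hEi, Matrix.exp_neg]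
  have hU : IsUnit (NormedSpace.exp (gen p)) := Matrix.isUnit_exp _
  rw [Matrix.mul_assoc _ etaMat etaMat, e2, Matrix.mul_one, Matrix.mul_assoc,
    Matrix.nonsing_inv_mul _ ((Matrix.isUnit_iff_isUnit_det _).mp hU), Matrix.mul_one]

lemma exp_half (p : Fin 3 → ℝ) :
    NormedSpace.exp (gen p) =
      NormedSpace.exp (gen ((1 / 2 : ℝ) • p)) * NormedSpace.exp (gen ((1 / 2 : ℝ) • p)) := by
  rw [← Matrix.exp_add_of_commute _ _ (Commute.refl _)]
  congr 1
  simp only [gen, ← Finset.sum_add_distrib, ← add_smul]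
  refine Finset.sum_congr rfl fun a _ => ?_
  congr 1
  simp only [Pi.smul_apply, smul_eq_mul]
  ring

/-- The exponential map `so(2,1) → L₃↑`, `ω^a J_a ↦ e^{ω^a J_a}`. -/
def expL (ω : Fin 3 → ℝ) : L3 :=
  ⟨⟨NormedSpace.exp (gen ω), by
    have h := congrArg Matrix.det (exp_form ((1 / 2 : ℝ) • ω))
    have hd : Matrix.det etaMat = 1 := by
      simp [etaMat, Matrix.det_diagonal, Fin.prod_univ_three, sgn]
    rw [Matrix.det_mul, Matrix.det_mul, Matrix.det_transpose, hd] at h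
    rw [exp_half, Matrix.det_mul]
    linarith⟩, exp_form ω, by
    change 0 < (NormedSpace.exp (gen ω)) 0 0
    rw [exp_half]
    have hf := exp_form ((1 / 2 : ℝ) • ω)
    have h1 := row_zero hf
    exact mul_zero_zero_pos hf hf (by
      rw [← sq, h1]
      positivity)⟩

/-! ### The Poincaré group -/

/-- The Poincaré group `P₃↑ = L₃↑ ⋉ ℝ³`, with elements `(u, a)`. -/
@[ext] structure P3 where
  u : L3
  a : Fin 3 → ℝ

namespace P3

instance : Mul P3 := ⟨fun x y => ⟨x.u * y.u, x.a + Ad x.u y.a⟩⟩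
instance : One P3 := ⟨⟨1, 0⟩⟩
instance : Inv P3 := ⟨fun x => ⟨x.u⁻¹, -Ad x.u⁻¹ x.a⟩⟩

instance : Group P3 :=
  Group.ofLeftAxioms
    (by
      rintro ⟨u, a⟩ ⟨v, b⟩ ⟨w, c⟩
      refine P3.ext (mul_assoc u v w) ?_
      change a + Ad u b + Ad (u * v) c = a + Ad u (b + Ad v c)
      have : lorMat (u * v) = lorMat u * lorMat v := rfl
      simp [Ad, this, Matrix.mulVec_add, add_assoc])
    (by
      rintro ⟨u, a⟩
      refine P3.ext (one_mul u) ?_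
      change 0 + Ad 1 a = a
      have : lorMat 1 = 1 := rfl
      simp [Ad, this])
    (by
      rintro ⟨u, a⟩
      refine P3.ext (inv_mul_cancel u) ?_
      change -Ad u⁻¹ a + Ad u⁻¹ a = 0
      simp)

/-- The parametrisation `(u, - Ad(u) j)` of Poincaré elements. -/
def ofJ (u : L3) (j : Fin 3 → ℝ) : P3 := ⟨u, -Ad u j⟩

/-- The vector `j` of a Poincaré element `h = (u, - Ad(u) j)`. -/
def j (h : P3) : Fin 3 → ℝ := -Ad h.u⁻¹ h.a

/-- The identification `(u, a) ≅ (1 + θ a^b J_b) u` of Poincaré elements with matrices over the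
ring `ℝ[θ]`, `θ² = 0`, of dual numbers. -/
def toDual (h : P3) : Matrix (Fin 3) (Fin 3) (DualNumber ℝ) :=
  (1 + gen fun b => (h.a b) • (DualNumber.eps : DualNumber ℝ)) *
    (lorMat h.u).map (algebraMap ℝ (DualNumber ℝ))

end P3

/-- `u` is hyperbolic: `u = e^{- p^a J_a}` with `p` spacelike. -/
def IsHyperbolic (u : L3) : Prop :=
  ∃ p : Fin 3 → ℝ, mink p p < 0 ∧ expL (-p) = u

open Classical in
/-- The spacelike vector `p` with `u = e^{- p^a J_a}` of a hyperbolic element `u`. -/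
def pvec (u : L3) : Fin 3 → ℝ :=
  if h : IsHyperbolic u then h.choose else 0

/-- `p + θ k`. -/
def dualVec (p k : Fin 3 → ℝ) : Fin 3 → DualNumber ℝ :=
  fun a => algebraMap ℝ (DualNumber ℝ) (p a) + (k a) • DualNumber.eps

open Classical in
/-- The vector `k` with `h = e^{- (p^a + θ k^a) J_a}`, for `h = (u, - Ad(u) j)` with `u = e^{- p^a J_a}`
hyperbolic. -/
def kvec (h : P3) : Fin 3 → ℝ :=
  if hk : ∃ k : Fin 3 → ℝ, NormedSpace.exp (-gen (dualVec (pvec h.u) k)) = h.toDual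
  then hk.choose else 0

/-- The mass `m` of a hyperbolic holonomy, `m² = - p²`. -/
def mass (h : P3) : ℝ := Real.sqrt (-mink (pvec h.u) (pvec h.u))

/-- The unit vector `p̂ = p / m`. -/
def phat (h : P3) : Fin 3 → ℝ := (1 / mass h) • pvec h.u

/-- The spin `s` of a hyperbolic holonomy, `m s = p · j`. -/
def spin (h : P3) : ℝ := mink (pvec h.u) h.j / mass h

/-! ### Curves and holonomies -/

/-- The generators `a_1, b_1, …, a_g, b_g` of the fundamental group of a genus `g` surface with a
disc removed. -/
inductive Gen (g : ℕ) where
  | a (i : Fin g) : Gen g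
  | b (i : Fin g) : Gen g
  deriving DecidableEq

instance (g : ℕ) : Fintype (Gen g) :=
  Fintype.ofEquiv (Fin g ⊕ Fin g)
    { toFun := Sum.elim Gen.a Gen.b
      invFun := fun X => match X with
        | Gen.a i => Sum.inl i
        | Gen.b i => Sum.inr i
      left_inv := by rintro (i | i) <;> rfl
      right_inv := by rintro (i | i) <;> rfl }

/-- A word `[z_1^{δ_1}, …, z_t^{δ_t}]`, listed in the order in which the curve
`z_t^{δ_t} ∘ … ∘ z_1^{δ_1}` runs through its letters; `true` stands for the exponent `1` and
`false` for the exponent `-1`. -/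
abbrev Word (g : ℕ) := List (Gen g × Bool)

/-- `f(x)^{δ}` for a letter `x^δ`. -/
def letter {g : ℕ} {G : Type*} [Group G] (f : Gen g → G) (l : Gen g × Bool) : G :=
  if l.2 then f l.1 else (f l.1)⁻¹

/-- `f(z_t)^{δ_t} ⋯ f(z_1)^{δ_1}`. -/
def wordProd {g : ℕ} {G : Type*} [Group G] (f : Gen g → G) (l : Word g) : G :=
  (l.map (letter f)).reverse.prod

/-- `h_i = [b_i, a_i⁻¹] = b_i a_i⁻¹ b_i⁻¹ a_i`. -/
def hElt {g : ℕ} {G : Type*} [Group G] (f : Gen g → G) (i : Fin g) : G :=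
  f (.b i) * (f (.a i))⁻¹ * (f (.b i))⁻¹ * f (.a i)

/-- `h_{i-1} ⋯ h_1`, the product over all handles before the `i`-th one. -/
def hProd {g : ℕ} {G : Type*} [Group G] (f : Gen g → G) (i : Fin g) : G :=
  (((List.finRange g).take i).map (hElt f)).reverse.prod

/-- The dual generators `n_{a_i} = h_1⁻¹ ⋯ h_i⁻¹ b_i h_{i-1} ⋯ h_1` and
`n_{b_i} = h_1⁻¹ ⋯ h_i⁻¹ a_i h_{i-1} ⋯ h_1`. -/
def dualGen {g : ℕ} {G : Type*} [Group G] (f : Gen g → G) : Gen g → G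
  | .a i => (hElt f i * hProd f i)⁻¹ * f (.b i) * hProd f i
  | .b i => (hElt f i * hProd f i)⁻¹ * f (.a i) * hProd f i

/-- A point of `(P₃↑)^{2g}`: the holonomies `A_1, B_1, …, A_g, B_g`. The holonomy of the curve with
word `l` is `wordProd c l`. -/
abbrev Config (g : ℕ) := Gen g → P3

/-- The Lorentz components of the holonomies. -/
def lor {g : ℕ} (c : Config g) : Gen g → L3 := fun X => (c X).u

/-! ### The grafting map -/

/-- The Lorentz components `v_X` of the dual holonomies `N_X`, where `v₀` is the Lorentz component
of the trivialising function at the basepoint. -/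
def dualLor {g : ℕ} (v₀ : L3) (c : Config g) : Gen g → L3 :=
  fun X => v₀ * dualGen (lor c) X * v₀⁻¹

/-- For `x = [x_1^{α_1}, …, x_r^{α_r}]`, the vector
`∑_{x_k = X, α_k = 1} Ad(v_{x_{k-1}}^{α_{k-1}} ⋯ v_{x_1}^{α_1}) n`
` - ∑_{x_k = X, α_k = -1} Ad(v_{x_k}^{α_k} ⋯ v_{x_1}^{α_1}) n`. -/
def sideSum {g : ℕ} (v : Gen g → L3) (x : Word g) (X : Gen g) (n : Fin 3 → ℝ) : Fin 3 → ℝ :=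
  ∑ k : Fin x.length,
    if (x.get k).1 = X then
      if (x.get k).2 then Ad (wordProd v (x.take k)) n else -Ad (wordProd v (x.take (k + 1))) n
    else 0

/-- The grafting map `Gr_{wλ}` for `λ = n_{x_r}^{α_r} ∘ … ∘ n_{x_1}^{α_1}`, in terms of the dual
holonomies. The unit normal of the geodesic `λ` is `n = - Ad(v₀) p̂_λ`, where
`H_λ = v₀⁻¹ v_{x_r}^{α_r} ⋯ v_{x_1}^{α_1} v₀` up to translations. -/
def graft {g : ℕ} (v₀ : L3) (x : Word g) (w : ℝ) (c : Config g) : Config g :=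
  let v := dualLor v₀ c
  let n : Fin 3 → ℝ := -Ad v₀ (phat (wordProd (dualGen c) x))
  fun
  | .a i => P3.ofJ (c (.a i)).u ((c (.a i)).j
      + w • Ad (v₀⁻¹ * (hProd v i)⁻¹) (sideSum v x (.a i) n))
  | .b i => P3.ofJ (c (.b i)).u ((c (.b i)).j
      - w • Ad (v₀⁻¹ * (hProd v i)⁻¹ * (v (.a i))⁻¹ * v (.b i)) (sideSum v x (.b i) n))

/-! ### Drawings of pairs of curves and their intersection points -/

/-- The place of the starting point `s_x` (`false`) and the endpoint `t_x` (`true`) of a generator in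
the order `s_{a_1} < s_{b_1} < t_{a_1} < t_{b_1} < s_{a_2} < …`. -/
def rank {g : ℕ} : Gen g → Bool → ℕ
  | .a i, false => 4 * i
  | .b i, false => 4 * i + 1
  | .a i, true => 4 * i + 2
  | .b i, true => 4 * i + 3

/-- A drawing of two closed curves `λ` (word `z`) and `η` (word `y`) on the surface with a disc
removed.

The surface is a horizontal strip above the disc, with one untwisted band for each generator `x`
attached to its upper side at the places `s_x` and `t_x`, which are ordered from right to left by
`rank`. Each letter of `λ` or `η` is a strand through the band of its generator. The strands of `η`
begin and end on a line at the disc and are connected along this line. Those of `λ` begin and end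
above it, the end of the strand of `z_k` and the start of the strand of `z_{k+1}` being connected by
a horizontal segment, the `k`-th one (`z_{t+1} = z_1`).

`pos i e` is the horizontal coordinate, increasing to the left, of strand `i` at the place `s_x`
(`e = false`) or `t_x` (`e = true`) of its generator `x`. Strands in one band do not cross, so that
the orders of two of them at `s_x` and at `t_x` are opposite. `layer k` is the height of the `k`-th
segment of `λ` among all segments of `λ`. -/
structure Drawing {g : ℕ} (z y : Word g) where
  pos : Fin z.length ⊕ Fin y.length → Bool → ℝ
  layer : Fin z.length ≃ Fin z.length
  pos_injective : Function.Injective fun q : (Fin z.length ⊕ Fin y.length) × Bool => pos q.1 q.2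
  pos_lt : ∀ i i' e e',
    rank (Sum.elim z.get y.get i).1 e < rank (Sum.elim z.get y.get i').1 e' → pos i e < pos i' e'
  parallel : ∀ i i', i ≠ i' → (Sum.elim z.get y.get i).1 = (Sum.elim z.get y.get i').1 →
    (pos i false < pos i' false ↔ pos i' true < pos i true)

/-- An intersection point of `λ` with `η`: it lies after the `k`-th factor of `λ` and after the
`l`-th factor of `η`, and `sign` is the oriented intersection number, `1` if `λ` crosses `η` from
the left to the right in the direction of `η`. -/
structure Crossing where
  k : ℕ
  l : ℕ
  sign : ℤ

namespace Drawing

variable {g : ℕ} {z y : Word g}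

/-- The position of the starting point of a letter, which is at `s_x` for `x` and at `t_x` for
`x⁻¹`. -/
def startPos (d : Drawing z y) (i : Fin z.length ⊕ Fin y.length) : ℝ :=
  d.pos i (!(Sum.elim z.get y.get i).2)

/-- The position of the endpoint of a letter. -/
def endPos (d : Drawing z y) (i : Fin z.length ⊕ Fin y.length) : ℝ :=
  d.pos i (Sum.elim z.get y.get i).2

open Classical in
/-- The intersection points near the starting point of the `j`-th factor of `η` (counted from `0`),
in the order in which `η`, which moves upwards there, passes through them. The `k`-th segment of `λ`
runs from left to right if it decreases the coordinate. -/
def startCrossings (d : Drawing z y) (j : Fin y.length) : List Crossing :=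
  ((List.finRange z.length).map d.layer.symm).filterMap fun k =>
    if d.endPos (.inl k) < d.startPos (.inr j) ∧
        d.startPos (.inr j) < d.startPos (.inl (finRotate _ k)) then
      some ⟨k + 1, j, -1⟩
    else if d.startPos (.inl (finRotate _ k)) < d.startPos (.inr j) ∧
        d.startPos (.inr j) < d.endPos (.inl k) then
      some ⟨k + 1, j, 1⟩
    else none

open Classical in
/-- The intersection points near the endpoint of the `j`-th factor of `η`, in the order in which `η`,
which moves downwards there, passes through them. -/
def endCrossings (d : Drawing z y) (j : Fin y.length) : List Crossing :=
  ((List.finRange z.length).map d.layer.symm).reverse.filterMap fun k =>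
    if d.endPos (.inl k) < d.endPos (.inr j) ∧
        d.endPos (.inr j) < d.startPos (.inl (finRotate _ k)) then
      some ⟨k + 1, j + 1, 1⟩
    else if d.startPos (.inl (finRotate _ k)) < d.endPos (.inr j) ∧
        d.endPos (.inr j) < d.endPos (.inl k) then
      some ⟨k + 1, j + 1, -1⟩
    else none

/-- The intersection points `q_1, …, q_n` of `λ` and `η`, in their order along `η`. -/
def crossings (d : Drawing z y) : List Crossing :=
  (List.finRange y.length).flatMap fun j => d.startCrossings j ++ d.endCrossings j

/-- The product `Y_s ⋯ Y_1` of the factors of `η` with the element `I q` inserted at each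
intersection point `q`. -/
def insertProd {M : Type*} [Monoid M] (d : Drawing z y) (Y : Gen g × Bool → M) (I : Crossing → M) :
    M :=
  ((List.finRange y.length).flatMap fun j =>
    (d.startCrossings j).map I ++ [Y (y.get j)] ++ (d.endCrossings j).map I).reverse.prod

/-- The image of `H_η` under the (infinitesimal) Dehn twist `D_{τλ}`, in the algebra of matrices
over the dual numbers; the parameter `τ` may be a real number or a dual number. At an intersection
point with intersection number `ε`, which lies after the `k`-th factor of `λ`, the element
`(Z_k ⋯ Z_1) e^{- τ ε (p_λ + θ k_λ)^a J_a} (Z_k ⋯ Z_1)⁻¹` is inserted. -/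
def dehn (d : Drawing z y) (τ : DualNumber ℝ) (c : Config g) :
    Matrix (Fin 3) (Fin 3) (DualNumber ℝ) :=
  d.insertProd (fun l => (letter c l).toDual) fun q =>
    (wordProd c (z.take q.k)).toDual *
      NormedSpace.exp (-((τ * (q.sign : DualNumber ℝ)) •
        gen (dualVec (pvec (wordProd c z).u) (kvec (wordProd c z))))) *
      ((wordProd c (z.take q.k))⁻¹).toDual

/-- The image of `H_η` under `G̃r_{tλ}`: at an intersection point with intersection number `ε`, the
element `(Z_k ⋯ Z_1) (1, - t ε p_λ) (Z_k ⋯ Z_1)⁻¹` is inserted. Here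
`(1, - t ε p_λ) ≅ e^{- θ t ε p_λ^a J_a}`. -/
def graftTilde (d : Drawing z y) (t : ℝ) (c : Config g) : P3 :=
  d.insertProd (letter c) fun q =>
    wordProd c (z.take q.k) * ⟨1, -((t * (q.sign : ℝ)) • pvec (wordProd c z).u)⟩ *
      (wordProd c (z.take q.k))⁻¹

/-- `- ∑_i ε_i (Ad(u_{Z_{k_i}} ⋯ u_{Z_1}) p̂_λ) · (Ad(u_{Y_{l_i}} ⋯ u_{Y_1}) p̂_η)`. -/
def bracketSum (d : Drawing z y) (c : Config g) : ℝ :=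
  -(d.crossings.map fun q => (q.sign : ℝ) *
    mink (Ad (wordProd (lor c) (z.take q.k)) (phat (wordProd c z)))
      (Ad (wordProd (lor c) (y.take q.l)) (phat (wordProd c y)))).sum

end Drawing

/-! ### The symplectic potential and the Poisson bracket -/

/-- The tangent space of `(P₃↑)^{2g}`: a vector has a Lorentz part and a `j`-part for each
generator. -/
abbrev Tangent (g : ℕ) := Gen g → (Fin 3 → ℝ) × (Fin 3 → ℝ)

/-- The exponential chart of `(P₃↑)^{2g}` centred at `c`:
`u_X ↦ e^{ω_X^a J_a} u_X`, `j_X ↦ j_X + κ_X`. -/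
def chart {g : ℕ} (c : Config g) (e : Tangent g) : Config g :=
  fun X => P3.ofJ (expL (e X).1 * (c X).u) ((c X).j + (e X).2)

/-- The pairing `⟨j, M⟩` of `j ≅ j^a P_a` with an element `M = ω^a J_a` of `so(2,1)`, that is, the
Minkowski product `j · ω`; note that `tr (J_a J_b) = - 2 η_{ab}`. -/
def pairing (j : Fin 3 → ℝ) (M : Matrix (Fin 3) (Fin 3) ℝ) : ℝ :=
  -(1 / 2) * (gen j * M).trace

lemma pairing_gen (j ω : Fin 3 → ℝ) : pairing j (gen ω) = mink j ω := by
  simp [pairing, mink, gen, J, lc, sgn, Matrix.trace, Matrix.mul_apply, Fin.sum_univ_three]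
  ring

/-- The one-form `(δ W) W⁻¹` of an `L₃↑`-valued function `W` on `(P₃↑)^{2g}`, in the chart centred at
`c`: its value at the point `e` on the tangent vector `ξ`. -/
def logDeriv {g : ℕ} (W : Config g → L3) (c : Config g) (e ξ : Tangent g) :
    Matrix (Fin 3) (Fin 3) ℝ :=
  (Matrix.of fun a b => fderiv ℝ (fun e' => lorMat (W (chart c e')) a b) e ξ) *
    lorMat (W (chart c e))⁻¹

/-- The symplectic potential `Θ` on `(P₃↑)^{2g}`, in the chart centred at `c`. -/
def theta {g : ℕ} (c : Config g) (e ξ : Tangent g) : ℝ :=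
  let W₁ (i : Fin g) (c : Config g) : L3 := hProd (lor c) i
  let W₂ (i : Fin g) (c : Config g) : L3 :=
    (lor c (.a i))⁻¹ * (lor c (.b i))⁻¹ * lor c (.a i) * hProd (lor c) i
  let W₃ (i : Fin g) (c : Config g) : L3 := (lor c (.b i))⁻¹ * lor c (.a i) * hProd (lor c) i
  ∑ i : Fin g,
    (pairing (chart c e (.a i)).j (logDeriv (W₁ i) c e ξ)
      - pairing (chart c e (.a i)).j (logDeriv (W₂ i) c e ξ)
      + pairing (chart c e (.b i)).j (logDeriv (W₂ i) c e ξ)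
      - pairing (chart c e (.b i)).j (logDeriv (W₃ i) c e ξ))

/-- The symplectic form `Ω = δΘ` at `c`. -/
def omega {g : ℕ} (c : Config g) (ξ ζ : Tangent g) : ℝ :=
  fderiv ℝ (fun e => theta c e ζ) 0 ξ - fderiv ℝ (fun e => theta c e ξ) 0 ζ

/-- `{F, G}(c) = r` for the Poisson bracket of `Ω`: the functions `F` and `G` are differentiable at
`c`, the form `Ω` is nondegenerate at `c`, and `r = dG(V)`, where `V` is the Hamiltonian vector of
`F` at `c`, `Ω(V, ·) = dF`. (For `Θ = p dq` this is the convention `{q, p} = 1`.) -/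
def HasPoissonBracket {g : ℕ} (F G : Config g → ℝ) (c : Config g) (r : ℝ) : Prop :=
  DifferentiableAt ℝ (F ∘ chart c) 0 ∧ DifferentiableAt ℝ (G ∘ chart c) 0 ∧
    (∀ V : Tangent g, (∀ ζ, omega c V ζ = 0) → V = 0) ∧
    ∃ V : Tangent g, (∀ ζ, omega c V ζ = fderiv ℝ (F ∘ chart c) 0 ζ) ∧
      fderiv ℝ (G ∘ chart c) 0 V = r

end Grafting

end

open scoped Matrix

noncomputable section

namespace Grafting

/-! ### Lorentz transformations -/

/-! Every transformation involved fixes the Lorentz parts, so all the content sits in the vectors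
`j`, which form a cocycle over the Lorentz parts. For a word they are computed by Fox calculus: by
`mink_wordProd_j`, `sideSum` is the transposed Fox derivative. The proof revolves around one vector
per generator, `twistJ`, the sum over `Y` of a kernel `twistKer u X Y` applied to the Fox derivative
of `λ` along `Y`. The kernel depends only on the two Lorentz parts and on the order of the ends of
the two bands.

The drawing yields this vector because the elements inserted by the modified grafting are commuting
translations. Near one strand of `η` only their sum matters, and that sum is a signed count of the
ends of strands of `λ` lying to the left of a vertical line. The difference between the two ends of
the strand is `twistJ` (`Drawing.Ad_lineSum`), whatever the heights and the order within a band.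

The grafting map yields the same vector by duality. Pairing `twistJ` at `X` with a fixed vector
evaluates a test cocycle on `λ`, and this depends only on the group element. The test cocycle
vanishes on all dual generators except `n_X` (`dualGen_testCfg_a_of_ne`), so rewriting `λ` in dual
generators leaves exactly the sum in the definition of grafting (`twistJ_a`, `twistJ_b`,
`graft_eq`). The Dehn twist with parameter `θw` agrees because `θ² = 0` removes `k_λ` and all higher
terms of the exponential.

For the brackets, `Ω` pairs a shift of the `j_X` with a coframe that is, up to `Ad`, the velocity
cocycle evaluated on the dual generators. Hence the shift by `twistJ` at `p̂_λ` is the Hamiltonian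
vector of the mass (`omega_twistVec`, `fderiv_mass`). The spin of `η` is affine in the `j_X`, and
its derivative along this vector is the sum over intersection points. The bracket of `s_λ` with
`m_η` then follows from antisymmetry of the intersection pairing (`twistVec_antisymm`), a
consequence of the fundamental formula of Fox calculus. -/

lemma lorMat_one : lorMat 1 = 1 := rfl

lemma lorMat_mul (u v : L3) : lorMat (u * v) = lorMat u * lorMat v := rfl

lemma lorMat_form (u : L3) : (lorMat u)ᵀ * etaMat * lorMat u = etaMat := u.2.1

lemma etaMat_mul_self : etaMat * etaMat = 1 := by
  ext i j
  fin_cases i <;> fin_cases j <;> simp [etaMat, sgn]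

lemma lorMat_inv_mul (u : L3) : lorMat u⁻¹ * lorMat u = 1 := by
  rw [← lorMat_mul, inv_mul_cancel, lorMat_one]

lemma lorMat_mul_inv (u : L3) : lorMat u * lorMat u⁻¹ = 1 := by
  rw [← lorMat_mul, mul_inv_cancel, lorMat_one]

/-- Makes the entries of an inverse linear in the entries of `u`, so that inverse letters can be
differentiated entrywise. -/
lemma lorMat_inv (u : L3) : lorMat u⁻¹ = etaMat * (lorMat u)ᵀ * etaMat := by
  have h : (etaMat * (lorMat u)ᵀ * etaMat) * lorMat u = 1 := by
    rw [Matrix.mul_assoc, Matrix.mul_assoc, ← Matrix.mul_assoc (lorMat u)ᵀ, lorMat_form,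
      etaMat_mul_self]
  calc lorMat u⁻¹ = (etaMat * (lorMat u)ᵀ * etaMat) * lorMat u * lorMat u⁻¹ := by
        rw [h, Matrix.one_mul]
    _ = _ := by rw [Matrix.mul_assoc, lorMat_mul_inv, Matrix.mul_one]

lemma lorMat_inv_apply (u : L3) (a b : Fin 3) :
    lorMat u⁻¹ a b = (sgn a : ℝ) * lorMat u b a * (sgn b : ℝ) := by
  rw [lorMat_inv, etaMat, Matrix.mul_diagonal, Matrix.diagonal_mul, Matrix.transpose_apply]

lemma Ad_one (x : Fin 3 → ℝ) : Ad 1 x = x := by simp [Ad, lorMat_one]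

lemma Ad_mul (u v : L3) (x : Fin 3 → ℝ) : Ad (u * v) x = Ad u (Ad v x) := by
  simp [Ad, lorMat_mul]

lemma Ad_add (u : L3) (x y : Fin 3 → ℝ) : Ad u (x + y) = Ad u x + Ad u y :=
  Matrix.mulVec_add _ _ _

lemma Ad_neg (u : L3) (x : Fin 3 → ℝ) : Ad u (-x) = -Ad u x := Matrix.mulVec_neg _ _

lemma Ad_sub (u : L3) (x y : Fin 3 → ℝ) : Ad u (x - y) = Ad u x - Ad u y :=
  Matrix.mulVec_sub _ _ _

lemma Ad_smul (u : L3) (r : ℝ) (x : Fin 3 → ℝ) : Ad u (r • x) = r • Ad u x :=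
  Matrix.mulVec_smul _ _ _

lemma Ad_zero (u : L3) : Ad u 0 = 0 := Matrix.mulVec_zero _

lemma Ad_sum {ι : Type*} (s : Finset ι) (u : L3) (f : ι → Fin 3 → ℝ) :
    Ad u (∑ i ∈ s, f i) = ∑ i ∈ s, Ad u (f i) :=
  map_sum (Matrix.mulVecLin (lorMat u)) f s

lemma Ad_inv_Ad (u : L3) (x : Fin 3 → ℝ) : Ad u⁻¹ (Ad u x) = x := by
  rw [← Ad_mul, inv_mul_cancel, Ad_one]

lemma Ad_Ad_inv (u : L3) (x : Fin 3 → ℝ) : Ad u (Ad u⁻¹ x) = x := by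
  rw [← Ad_mul, mul_inv_cancel, Ad_one]

/-! ### The Minkowski product -/

lemma mink_eq_dotProduct (x y : Fin 3 → ℝ) : mink x y = x ⬝ᵥ etaMat *ᵥ y := by
  simp [mink, dotProduct, etaMat, Matrix.mulVec_diagonal]
  simp only [Fin.sum_univ_three]; ring

lemma mink_comm (x y : Fin 3 → ℝ) : mink x y = mink y x := by
  simp only [mink, Fin.sum_univ_three]; ring

lemma mink_add_right (x y z : Fin 3 → ℝ) : mink x (y + z) = mink x y + mink x z := by
  simp only [mink, Fin.sum_univ_three, Pi.add_apply]; ring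

lemma mink_add_left (x y z : Fin 3 → ℝ) : mink (x + y) z = mink x z + mink y z := by
  simp only [mink, Fin.sum_univ_three, Pi.add_apply]; ring

lemma mink_smul_right (r : ℝ) (x y : Fin 3 → ℝ) : mink x (r • y) = r * mink x y := by
  simp only [mink, Fin.sum_univ_three, Pi.smul_apply, smul_eq_mul]; ring

lemma mink_smul_left (r : ℝ) (x y : Fin 3 → ℝ) : mink (r • x) y = r * mink x y := by
  simp only [mink, Fin.sum_univ_three, Pi.smul_apply, smul_eq_mul]; ring

lemma mink_neg_right (x y : Fin 3 → ℝ) : mink x (-y) = -mink x y := by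
  simp only [mink, Fin.sum_univ_three, Pi.neg_apply]; ring

lemma mink_neg_left (x y : Fin 3 → ℝ) : mink (-x) y = -mink x y := by
  simp only [mink, Fin.sum_univ_three, Pi.neg_apply]; ring

lemma mink_sub_right (x y z : Fin 3 → ℝ) : mink x (y - z) = mink x y - mink x z := by
  simp only [mink, Fin.sum_univ_three, Pi.sub_apply]; ring

lemma mink_sub_left (x y z : Fin 3 → ℝ) : mink (x - y) z = mink x z - mink y z := by
  simp only [mink, Fin.sum_univ_three, Pi.sub_apply]; ring

lemma mink_zero_right (x : Fin 3 → ℝ) : mink x 0 = 0 := by simp [mink]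

lemma mink_zero_left (x : Fin 3 → ℝ) : mink 0 x = 0 := by simp [mink]

lemma mink_sum_right {ι : Type*} (s : Finset ι) (x : Fin 3 → ℝ) (f : ι → Fin 3 → ℝ) :
    mink x (∑ i ∈ s, f i) = ∑ i ∈ s, mink x (f i) := by
  classical
  induction s using Finset.induction_on with
  | empty => simp [mink_zero_right]
  | insert a s ha ih => rw [Finset.sum_insert ha, Finset.sum_insert ha, mink_add_right, ih]

lemma mink_sum_left {ι : Type*} (s : Finset ι) (x : Fin 3 → ℝ) (f : ι → Fin 3 → ℝ) :
    mink (∑ i ∈ s, f i) x = ∑ i ∈ s, mink (f i) x := by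
  simp only [mink_comm _ x, mink_sum_right]

lemma mink_Ad_Ad (u : L3) (x y : Fin 3 → ℝ) : mink (Ad u x) (Ad u y) = mink x y := by
  rw [mink_eq_dotProduct, mink_eq_dotProduct, Ad, Ad, Matrix.mulVec_mulVec,
    ← Matrix.vecMul_transpose, ← Matrix.dotProduct_mulVec, Matrix.mulVec_mulVec, ← Matrix.mul_assoc, lorMat_form]

lemma mink_Ad_left (u : L3) (x y : Fin 3 → ℝ) : mink (Ad u x) y = mink x (Ad u⁻¹ y) := by
  rw [← mink_Ad_Ad u x, Ad_Ad_inv]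

lemma mink_Ad_right (u : L3) (x y : Fin 3 → ℝ) : mink x (Ad u y) = mink (Ad u⁻¹ x) y := by
  rw [← mink_Ad_Ad u _ y, Ad_Ad_inv]

/-- The Minkowski product is nondegenerate. -/
lemma eq_of_forall_mink {x y : Fin 3 → ℝ} (h : ∀ v, mink v x = mink v y) : x = y := by
  ext a
  have := h (Pi.single a 1)
  fin_cases a <;> simpa [mink, Fin.sum_univ_three, sgn] using this

/-! ### Equivariance of `p ↦ p^a J_a` -/

section gen

variable {R : Type*} [CommRing R]

lemma gen_add (p q : Fin 3 → R) : gen (p + q) = gen p + gen q := by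
  simp [gen, add_smul, Finset.sum_add_distrib]

lemma gen_smul (r : R) (p : Fin 3 → R) : gen (r • p) = r • gen p := by
  simp [gen, Finset.smul_sum, smul_smul]

lemma gen_neg (p : Fin 3 → R) : gen (-p) = -gen p := by
  simp [gen]

lemma gen_zero : gen (0 : Fin 3 → R) = 0 := by simp [gen]

lemma gen_eq (p : Fin 3 → R) :
    gen p = !![0, -p 2, p 1; -p 2, 0, p 0; p 1, -p 0, 0] := by
  ext i j
  fin_cases i <;> fin_cases j <;> simp [gen, J, lc, sgn, Fin.sum_univ_three]

end gen

lemma adjugate_lorMat (u : L3) : (lorMat u).adjugate = lorMat u⁻¹ := rfl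

/-- The inverse of `u` is both its adjugate and its `η`-transpose. Equating the two gives nine
quadratic relations between the entries, and each entry of the claim is a linear combination of
these with coefficients from `x`. -/
lemma gen_Ad_mul (u : L3) (x : Fin 3 → ℝ) : gen (Ad u x) * lorMat u = lorMat u * gen x := by
  have hm : ∀ a b, (lorMat u).adjugate a b = (sgn a : ℝ) * lorMat u b a * (sgn b : ℝ) := by
    intro a b
    rw [adjugate_lorMat, lorMat_inv_apply]
  rw [Matrix.adjugate_fin_three] at hm
  have h00 := hm 0 0
  have h01 := hm 0 1
  have h02 := hm 0 2
  have h10 := hm 1 0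
  have h11 := hm 1 1
  have h12 := hm 1 2
  have h20 := hm 2 0
  have h21 := hm 2 1
  have h22 := hm 2 2
  simp [sgn] at h00 h01 h02 h10 h11 h12 h20 h21 h22
  rw [gen_eq, gen_eq]
  ext i j
  fin_cases i <;> fin_cases j <;>
    simp [Ad, Matrix.mul_apply, Matrix.mulVec, dotProduct, Fin.sum_univ_three]
  · linear_combination x 2 * h10 - x 1 * h20
  · linear_combination x 0 * h20 - x 2 * h00
  · linear_combination x 1 * h00 - x 0 * h10
  · linear_combination x 1 * h21 - x 2 * h11
  · linear_combination x 2 * h01 - x 0 * h21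
  · linear_combination x 0 * h11 - x 1 * h01
  · linear_combination x 1 * h22 - x 2 * h12
  · linear_combination x 2 * h02 - x 0 * h22
  · linear_combination x 0 * h12 - x 1 * h02

/-! ### The Poincaré group -/

namespace P3

@[simp] lemma mul_u (g h : P3) : (g * h).u = g.u * h.u := rfl
@[simp] lemma mul_a (g h : P3) : (g * h).a = g.a + Ad g.u h.a := rfl
@[simp] lemma one_u : (1 : P3).u = 1 := rfl
@[simp] lemma one_a : (1 : P3).a = 0 := rfl
@[simp] lemma inv_u (g : P3) : g⁻¹.u = g.u⁻¹ := rfl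
@[simp] lemma inv_a (g : P3) : g⁻¹.a = -Ad g.u⁻¹ g.a := rfl
@[simp] lemma ofJ_u (u : L3) (j : Fin 3 → ℝ) : (ofJ u j).u = u := rfl
@[simp] lemma ofJ_a (u : L3) (j : Fin 3 → ℝ) : (ofJ u j).a = -Ad u j := rfl

@[simp] lemma ofJ_j (u : L3) (j : Fin 3 → ℝ) : (ofJ u j).j = j := by
  simp [P3.j, Ad_neg, Ad_inv_Ad]

lemma ofJ_self (h : P3) : ofJ h.u h.j = h :=
  P3.ext rfl (by simp [P3.j, Ad_neg, Ad_Ad_inv])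

lemma a_eq (h : P3) : h.a = -Ad h.u h.j := by
  simp [P3.j, Ad_neg, Ad_Ad_inv]

lemma mul_j (g h : P3) : (g * h).j = h.j + Ad h.u⁻¹ g.j := by
  simp only [P3.j, mul_u, mul_a, mul_inv_rev, Ad_add, Ad_mul, Ad_inv_Ad, Ad_neg]
  abel

lemma one_j : (1 : P3).j = 0 := by simp [P3.j, Ad_zero]

lemma inv_j (h : P3) : h⁻¹.j = -Ad h.u h.j := by
  simp [P3.j, Ad_neg, Ad_Ad_inv]

/-- The Lorentz component, as a homomorphism. -/
def uHom : P3 →* L3 where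
  toFun := P3.u
  map_one' := rfl
  map_mul' _ _ := rfl

@[simp] lemma uHom_apply (h : P3) : uHom h = h.u := rfl

end P3

/-! ### Words -/

section words

variable {g : ℕ} {G H : Type*} [Group G] [Group H]

@[simp] lemma wordProd_nil (f : Gen g → G) : wordProd f [] = 1 := rfl

@[simp] lemma wordProd_cons (f : Gen g → G) (l : Gen g × Bool) (x : Word g) :
    wordProd f (l :: x) = wordProd f x * letter f l := by
  simp [wordProd]

lemma wordProd_append (f : Gen g → G) (x y : Word g) :
    wordProd f (x ++ y) = wordProd f y * wordProd f x := by
  simp [wordProd]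

lemma map_letter (φ : G →* H) (f : Gen g → G) (l : Gen g × Bool) :
    letter (fun X => φ (f X)) l = φ (letter f l) := by
  unfold letter; split_ifs <;> simp

lemma map_wordProd (φ : G →* H) (f : Gen g → G) (x : Word g) :
    wordProd (fun X => φ (f X)) x = φ (wordProd f x) := by
  induction x with
  | nil => simp
  | cons l x ih => simp [ih, map_letter]

lemma map_hElt (φ : G →* H) (f : Gen g → G) (i : Fin g) :
    hElt (fun X => φ (f X)) i = φ (hElt f i) := by
  simp [hElt]

lemma map_hProd (φ : G →* H) (f : Gen g → G) (i : Fin g) :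
    hProd (fun X => φ (f X)) i = φ (hProd f i) := by
  simp only [hProd, map_list_prod, List.map_reverse, List.map_map]
  congr 3
  funext i
  exact map_hElt φ f i

lemma map_dualGen (φ : G →* H) (f : Gen g → G) (X : Gen g) :
    dualGen (fun X => φ (f X)) X = φ (dualGen f X) := by
  cases X <;> simp [dualGen, map_hElt, map_hProd]

lemma wordProd_eq_lift (f : Gen g → G) (x : Word g) :
    wordProd f x = FreeGroup.lift f (wordProd FreeGroup.of x) := by
  rw [← map_wordProd]; simp

lemma hProd_eq_lift (f : Gen g → G) (i : Fin g) :
    hProd f i = FreeGroup.lift f (hProd FreeGroup.of i) := by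
  rw [← map_hProd]; simp

/-- The equality of the two words is assumed only in the free group; the universal property carries
it to holonomies, Lorentz parts and cocycles alike. -/
lemma wordProd_dualGen_eq (f : Gen g → G) (x z : Word g)
    (h : wordProd (dualGen FreeGroup.of) x = wordProd FreeGroup.of z) :
    wordProd (dualGen f) x = wordProd f z := by
  rw [wordProd_eq_lift f z, ← h, ← map_wordProd]
  congr 1
  funext X
  rw [← map_dualGen]; simp

lemma hProd_zero (f : Gen g → G) (h : 0 < g) : hProd f ⟨0, h⟩ = 1 := by
  simp [hProd]

lemma hProd_succ (f : Gen g → G) (n : ℕ) (h : n + 1 < g) :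
    hProd f ⟨n + 1, h⟩ = hElt f ⟨n, by omega⟩ * hProd f ⟨n, by omega⟩ := by
  simp only [hProd]
  rw [List.take_succ_eq_append_getElem (by simpa using (by omega : n < g))]
  simp

/-- A property that is preserved by `W ↦ h_i W` and holds at `1` holds for all `h_{i-1} ⋯ h_1`;
it may depend on the handle. -/
lemma hProd_induction (f : Gen g → G) (p : ℕ → G → Prop) (h0 : p 0 1)
    (hs : ∀ (i : Fin g), p i (hProd f i) → p (i + 1) (hElt f i * hProd f i)) (i : Fin g) :
    p i (hProd f i) := by
  obtain ⟨n, hn⟩ := i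
  induction n with
  | zero => rw [hProd_zero]; exact h0
  | succ n ih =>
    rw [hProd_succ]
    exact hs ⟨n, by omega⟩ (ih (by omega))

lemma hElt_dualGen (f : Gen g → G) (i : Fin g) :
    hElt (dualGen f) i = (hElt f i * hProd f i)⁻¹ * hProd f i := by
  simp [hElt, dualGen, mul_assoc]

/-- The commutators of the dual generators are `(h_i W_i)⁻¹ W_i` with `W_i = h_{i-1} ⋯ h_1`, so
their product telescopes. This identifies the prefactors in the grafting map. -/
lemma hProd_dualGen (f : Gen g → G) (i : Fin g) : hProd (dualGen f) i = (hProd f i)⁻¹ := by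
  obtain ⟨n, hn⟩ := i
  induction n with
  | zero => simp [hProd_zero]
  | succ n ih =>
    rw [hProd_succ, hProd_succ, ih, hElt_dualGen]
    simp [mul_assoc]

end words

/-! ### Free differential calculus for words in the Poincaré group -/

section calculus

variable {g : ℕ}

lemma sideSum_nil (v : Gen g → L3) (X : Gen g) (n : Fin 3 → ℝ) : sideSum v [] X n = 0 := by
  simp [sideSum]

lemma sideSum_cons (v : Gen g → L3) (l : Gen g × Bool) (x : Word g) (X : Gen g)
    (n : Fin 3 → ℝ) :
    sideSum v (l :: x) X n =
      (if l.1 = X then if l.2 then n else -Ad (letter v l) n else 0) +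
        sideSum v x X (Ad (letter v l) n) := by
  simp only [sideSum]
  refine (Fin.sum_univ_succ (n := x.length) _).trans ?_
  simp [Ad_one, Ad_mul]

lemma sideSum_smul (v : Gen g → L3) (x : Word g) (X : Gen g) (r : ℝ) (n : Fin 3 → ℝ) :
    sideSum v x X (r • n) = r • sideSum v x X n := by
  simp only [sideSum, Finset.smul_sum]
  refine Finset.sum_congr rfl fun k _ => ?_
  split_ifs <;> simp [Ad_smul]

lemma sideSum_neg (v : Gen g → L3) (x : Word g) (X : Gen g) (n : Fin 3 → ℝ) :
    sideSum v x X (-n) = -sideSum v x X n := by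
  rw [← neg_one_smul ℝ, sideSum_smul, neg_one_smul]

lemma letter_conj {G : Type*} [Group G] (v₀ : G) (u : Gen g → G) (l : Gen g × Bool) :
    letter (fun X => v₀ * u X * v₀⁻¹) l = v₀ * letter u l * v₀⁻¹ := by
  unfold letter; split_ifs <;> simp [mul_assoc]

lemma sideSum_conj (v₀ : L3) (u : Gen g → L3) (x : Word g) (X : Gen g) (n : Fin 3 → ℝ) :
    sideSum (fun X => v₀ * u X * v₀⁻¹) x X (Ad v₀ n) = Ad v₀ (sideSum u x X n) := by
  induction x generalizing n with
  | nil => simp [sideSum_nil, Ad_zero]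
  | cons l x ih =>
    have h : Ad (letter (fun X => v₀ * u X * v₀⁻¹) l) (Ad v₀ n) = Ad v₀ (Ad (letter u l) n) := by
      simp [letter_conj, Ad_mul, Ad_inv_Ad]
    rw [sideSum_cons, sideSum_cons, h, ih, Ad_add]
    congr 1
    split_ifs <;> simp [Ad_neg, Ad_zero]

/-- The vectors `j` of the holonomies form a cocycle, so that `j` of a word is given by the free
derivatives of the word. -/
lemma mink_wordProd_j (f : Gen g → P3) (x : Word g) (p : Fin 3 → ℝ) :
    mink p (wordProd f x).j =
      ∑ X, mink (sideSum (fun X => (f X).u) x X p) (f X).j := by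
  induction x generalizing p with
  | nil => simp [P3.one_j, mink_zero_right, sideSum_nil, mink_zero_left]
  | cons l x ih =>
    have hl : (letter f l).u = letter (fun X => (f X).u) l := (map_letter P3.uHom f l).symm
    simp only [sideSum_cons, mink_add_left, Finset.sum_add_distrib, wordProd_cons, P3.mul_j,
      mink_add_right, mink_Ad_right, inv_inv, ih, hl]
    congr 1
    rw [Finset.sum_eq_single l.1 (fun X _ hX => by rw [if_neg hX.symm, mink_zero_left])
      (fun h => absurd (Finset.mem_univ _) h), if_pos rfl]
    unfold letter
    split_ifs
    · rfl
    · rw [P3.inv_j, mink_neg_right, mink_Ad_right, mink_neg_left]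

lemma mink_wordProd_ofJ_j (u : Gen g → L3) (κ : Gen g → Fin 3 → ℝ) (x : Word g)
    (p : Fin 3 → ℝ) :
    mink p (wordProd (fun X => P3.ofJ (u X) (κ X)) x).j =
      ∑ X, mink (sideSum u x X p) (κ X) := by
  simp [mink_wordProd_j]

lemma wordProd_u (f : Gen g → P3) (x : Word g) :
    (wordProd f x).u = wordProd (fun X => (f X).u) x := (map_wordProd P3.uHom f x).symm

lemma hProd_u (f : Gen g → P3) (i : Fin g) :
    (hProd f i).u = hProd (fun X => (f X).u) i := (map_hProd P3.uHom f i).symm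

lemma dualGen_u (f : Gen g → P3) (X : Gen g) :
    (dualGen f X).u = dualGen (fun X => (f X).u) X := (map_dualGen P3.uHom f X).symm

/-! ### The twist cocycle and its test cocycles -/

/-- The coefficients of the intersection pairing of two generators: the crossings of a strand
parallel to `X` with the segments next to a strand parallel to `Y`. -/
def twistKer (u : Gen g → L3) (X Y : Gen g) (q : Fin 3 → ℝ) : Fin 3 → ℝ :=
  (if rank X true ≤ rank Y true then Ad ((u X)⁻¹ * u Y) q else 0)
    - (if rank X true < rank Y false then Ad (u X)⁻¹ q else 0)
    - (if rank X false < rank Y true then Ad (u Y) q else 0)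
    + (if rank X false < rank Y false then q else 0)

/-- The variation of `j_X` under the twist along the curve with word `z`, for an element `p` fixed
by its holonomy. -/
def twistJ (u : Gen g → L3) (z : Word g) (p : Fin 3 → ℝ) (X : Gen g) : Fin 3 → ℝ :=
  ∑ Y, twistKer u X Y (sideSum u z Y p)

/-- The adjoint of `twistKer`. -/
def twistKerAdj (u : Gen g → L3) (X Y : Gen g) (v : Fin 3 → ℝ) : Fin 3 → ℝ :=
  (if rank X true ≤ rank Y true then Ad ((u Y)⁻¹ * u X) v else 0)
    - (if rank X true < rank Y false then Ad (u X) v else 0)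
    - (if rank X false < rank Y true then Ad (u Y)⁻¹ v else 0)
    + (if rank X false < rank Y false then v else 0)

lemma mink_twistKer (u : Gen g → L3) (X Y : Gen g) (v q : Fin 3 → ℝ) :
    mink v (twistKer u X Y q) = mink q (twistKerAdj u X Y v) := by
  rw [mink_comm q]
  simp only [twistKer, twistKerAdj, mink_add_right, mink_sub_right, mink_add_left, mink_sub_left,
    apply_ite (mink v), apply_ite (fun w => mink w q), mink_zero_right, mink_zero_left,
    mink_Ad_right, mul_inv_rev, inv_inv]

/-- The cocycle dual to the generator `X`. -/
def testCfg (u : Gen g → L3) (X : Gen g) (v : Fin 3 → ℝ) : Gen g → P3 :=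
  fun Y => P3.ofJ (u Y) (twistKerAdj u X Y v)

/-- Transposing the kernel turns the sum over generators into the Fox expansion of a holonomy. The
right side depends on `z` only through the element it represents, which is what permits a change of
generators. -/
lemma mink_twistJ (u : Gen g → L3) (z : Word g) (p v : Fin 3 → ℝ) (X : Gen g) :
    mink v (twistJ u z p X) = mink p (wordProd (testCfg u X v) z).j := by
  simp only [twistJ, mink_sum_right, mink_twistKer]
  exact (mink_wordProd_ofJ_j u (fun Y => twistKerAdj u X Y v) z p).symm

lemma testCfg_u (u : Gen g → L3) (X Y : Gen g) (v : Fin 3 → ℝ) : (testCfg u X v Y).u = u Y := rfl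

/-- The handle of a generator. -/
def handle : Gen g → Fin g
  | .a i => i
  | .b i => i

lemma handle_a (i : Fin g) : handle (.a i) = i := rfl

lemma handle_b (i : Fin g) : handle (.b i) = i := rfl

lemma rank_lt_of_handle_lt {X Y : Gen g} (h : handle X < handle Y) (e e' : Bool) :
    rank X e < rank Y e' := by
  have h' : (handle X : ℕ) < handle Y := h
  cases X <;> cases Y <;> cases e <;> cases e' <;> simp only [handle_a, handle_b] at h' <;>
    simp only [rank] <;> omega

lemma testCfg_a_eq (u : Gen g → L3) (X Y : Gen g) (v : Fin 3 → ℝ) :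
    (testCfg u X v Y).a =
      -(if rank X true ≤ rank Y true then Ad (u X) v else 0)
        + (if rank X true < rank Y false then Ad (u Y) (Ad (u X) v) else 0)
        + (if rank X false < rank Y true then v else 0)
        - (if rank X false < rank Y false then Ad (u Y) v else 0) := by
  simp only [testCfg, P3.ofJ_a, twistKerAdj, Ad_add, Ad_sub, apply_ite (Ad (u Y)), Ad_zero,
    Ad_mul, Ad_Ad_inv]
  abel

lemma testCfg_a_of_lt (u : Gen g → L3) (X Y : Gen g) (v : Fin 3 → ℝ) (h : handle Y < handle X) :
    (testCfg u X v Y).a = 0 := by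
  have hr := fun e e' => rank_lt_of_handle_lt h e e'
  rw [testCfg_a_eq, if_neg (hr _ _).not_ge, if_neg (hr _ _).not_gt, if_neg (hr _ _).not_gt,
    if_neg (hr _ _).not_gt]
  simp

/-- On later handles the test cocycle is the coboundary of `e = v - Ad(u_X) v`; on earlier ones it
is zero. Only the handle of `X` needs a computation of its own. -/
lemma testCfg_a_of_gt (u : Gen g → L3) (X Y : Gen g) (v : Fin 3 → ℝ) (h : handle X < handle Y) :
    (testCfg u X v Y).a = (v - Ad (u X) v) - Ad (u Y) (v - Ad (u X) v) := by
  have hr := fun e e' => rank_lt_of_handle_lt h e e'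
  rw [testCfg_a_eq, if_pos (hr _ _).le, if_pos (hr _ _), if_pos (hr _ _), if_pos (hr _ _), Ad_sub]
  abel

lemma testCfg_aa (u : Gen g → L3) (i : Fin g) (v : Fin 3 → ℝ) :
    (testCfg u (.a i) v (.a i)).a = v - Ad (u (.a i)) v := by
  rw [testCfg_a_eq]; simp [rank]; abel

lemma testCfg_ab (u : Gen g → L3) (i : Fin g) (v : Fin 3 → ℝ) :
    (testCfg u (.a i) v (.b i)).a = v - Ad (u (.a i)) v - Ad (u (.b i)) v := by
  rw [testCfg_a_eq]; simp [rank]; abel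

lemma testCfg_ba (u : Gen g → L3) (i : Fin g) (v : Fin 3 → ℝ) :
    (testCfg u (.b i) v (.a i)).a = v := by
  rw [testCfg_a_eq]; simp [rank]

lemma testCfg_bb (u : Gen g → L3) (i : Fin g) (v : Fin 3 → ℝ) :
    (testCfg u (.b i) v (.b i)).a = v - Ad (u (.b i)) v := by
  rw [testCfg_a_eq]; simp [rank]; abel

/-- Both kinds of generator give the same `e = v - Ad(u_X) v`, exactly the vector whose coboundary
appears on the later handles. -/
lemma hElt_testCfg_a (u : Gen g → L3) (X : Gen g) (v : Fin 3 → ℝ) :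
    (hElt (testCfg u X v) (handle X)).a = v - Ad (u X) v := by
  cases X with
  | a i =>
    simp only [handle, hElt, P3.mul_a, P3.inv_a, P3.mul_u, P3.inv_u, testCfg_u, testCfg_aa,
      testCfg_ab, Ad_sub, Ad_neg, Ad_mul, Ad_inv_Ad]
    abel
  | b i =>
    simp only [handle, hElt, P3.mul_a, P3.inv_a, P3.mul_u, P3.inv_u, testCfg_u, testCfg_ba,
      testCfg_bb, Ad_sub, Ad_neg, Ad_mul, Ad_inv_Ad]
    abel

/-- One induction step over the handles: nothing is contributed before `X`, its own handle
contributes `e = v - Ad(u_X) v`, and afterwards the coboundary `e - Ad(h) e` plus `Ad(h) e` is again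
`e`. -/
lemma hProd_testCfg_a_aux (u : Gen g → L3) (X : Gen g) (v : Fin 3 → ℝ) (k : Fin g)
    (h : (hProd (testCfg u X v) k).a = if (k : ℕ) ≤ handle X then 0 else v - Ad (u X) v) :
    (hElt (testCfg u X v) k * hProd (testCfg u X v) k).a =
      if (k : ℕ) + 1 ≤ handle X then 0 else v - Ad (u X) v := by
  rw [P3.mul_a, h]
  rcases lt_trichotomy k (handle X) with hk | hk | hk
  · have hk' : (k : ℕ) < handle X := hk
    rw [if_pos (by omega), if_pos (by omega)]
    have ha := testCfg_a_of_lt u X (.a k) v hk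
    have hb := testCfg_a_of_lt u X (.b k) v hk
    simp [hElt, ha, hb, Ad_zero]
  · subst hk
    rw [if_pos le_rfl, if_neg (by omega), hElt_testCfg_a, Ad_zero, add_zero]
  · have hk' : (handle X : ℕ) < k := hk
    rw [if_neg (by omega), if_neg (by omega)]
    have ha := testCfg_a_of_gt u X (.a k) v hk
    have hb := testCfg_a_of_gt u X (.b k) v hk
    generalize v - Ad (u X) v = e at *
    simp only [hElt, P3.mul_a, P3.inv_a, P3.mul_u, P3.inv_u, ha, hb, testCfg_u, Ad_sub, Ad_neg,
      Ad_mul, Ad_inv_Ad]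
    abel

lemma hProd_testCfg_a (u : Gen g → L3) (X : Gen g) (v : Fin 3 → ℝ) (k : Fin g) :
    (hProd (testCfg u X v) k).a = if (k : ℕ) ≤ handle X then 0 else v - Ad (u X) v :=
  hProd_induction (testCfg u X v)
    (fun k G => G.a = if k ≤ (handle X : ℕ) then 0 else v - Ad (u X) v) (by simp)
    (fun k h => hProd_testCfg_a_aux u X v k h) k

lemma inv_mul_mul_a (G b W : P3) :
    (G⁻¹ * b * W).a = Ad G.u⁻¹ (b.a + Ad b.u W.a - G.a) := by
  simp only [P3.mul_a, P3.inv_a, P3.mul_u, P3.inv_u, Ad_mul, Ad_add, Ad_sub]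
  abel

/-- In `n_Y = (h W)⁻¹ y' W`, with `y'` the partner of `Y` in its handle, the translation parts
cancel: before `X` all vanish, after `X` all come from one coboundary, and in the handle of `X`
those of `y'` and `h W` coincide while that of `W` is zero. -/
lemma dualGen_testCfg_a_of_ne (u : Gen g → L3) (X Y : Gen g) (v : Fin 3 → ℝ) (h : Y ≠ X) :
    (dualGen (testCfg u X v) Y).a = 0 := by
  have hW := hProd_testCfg_a u X v (handle Y)
  have hG := hProd_testCfg_a_aux u X v (handle Y) hW
  rcases lt_trichotomy (handle Y) (handle X) with hk | hk | hk
  · have hk' : (handle Y : ℕ) < handle X := hk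
    rw [if_pos (by omega)] at hW hG
    have ha := testCfg_a_of_lt u X (.a (handle Y)) v hk
    have hb := testCfg_a_of_lt u X (.b (handle Y)) v hk
    cases Y <;> simp only [handle_a, handle_b] at hW hG ha hb <;>
      simp only [dualGen, inv_mul_mul_a, hW, hG, ha, hb] <;> simp [Ad_zero]
  · rw [hk, if_pos le_rfl, ← hk] at hW
    rw [hk, if_neg (by omega), ← hk] at hG
    cases X <;> cases Y <;> simp only [handle_a, handle_b] at hk <;> subst hk <;>
      first
      | exact absurd rfl h
      | (simp only [handle_a, handle_b] at hW hG
         simp only [dualGen, inv_mul_mul_a, hW, hG, testCfg_aa, testCfg_bb, Ad_zero]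
         simp [Ad_zero])
  · have hk' : (handle X : ℕ) < handle Y := hk
    rw [if_neg (by omega)] at hW hG
    have ha := testCfg_a_of_gt u X (.a (handle Y)) v hk
    have hb := testCfg_a_of_gt u X (.b (handle Y)) v hk
    cases Y <;> simp only [handle_a, handle_b] at hW hG ha hb <;>
      simp only [dualGen, inv_mul_mul_a, hW, hG, ha, hb] <;> simp [Ad_zero, testCfg_u]

lemma dualGen_testCfg_j_of_ne (u : Gen g → L3) (X Y : Gen g) (v : Fin 3 → ℝ) (h : Y ≠ X) :
    (dualGen (testCfg u X v) Y).j = 0 := by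
  rw [P3.j, dualGen_testCfg_a_of_ne u X Y v h, Ad_zero, neg_zero]

lemma dualGen_testCfg_j_a (u : Gen g → L3) (i : Fin g) (v : Fin 3 → ℝ) :
    (dualGen (testCfg u (.a i) v) (.a i)).j = Ad (hProd u i)⁻¹ v := by
  have hW := hProd_testCfg_a u (.a i) v i
  have hG := hProd_testCfg_a_aux u (.a i) v i hW
  rw [handle_a, if_pos le_rfl] at hW
  rw [if_neg (by simp [handle])] at hG
  have hu : (hProd (testCfg u (.a i) v) i).u = hProd u i := hProd_u _ _
  rw [P3.j, dualGen, inv_mul_mul_a, hW, hG, testCfg_ab]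
  simp only [Ad_zero, P3.mul_u, P3.inv_u, hu, mul_inv_rev, Ad_mul, testCfg_u, inv_inv, add_zero,
    sub_sub_cancel_left, Ad_neg, neg_neg, Ad_Ad_inv, Ad_inv_Ad]

lemma dualGen_testCfg_j_b (u : Gen g → L3) (i : Fin g) (v : Fin 3 → ℝ) :
    (dualGen (testCfg u (.b i) v) (.b i)).j =
      -Ad ((u (.b i))⁻¹ * u (.a i) * hProd u i)⁻¹ v := by
  have hW := hProd_testCfg_a u (.b i) v i
  have hG := hProd_testCfg_a_aux u (.b i) v i hW
  rw [handle_b, if_pos le_rfl] at hW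
  rw [if_neg (by simp [handle])] at hG
  have hu : (hProd (testCfg u (.b i) v) i).u = hProd u i := hProd_u _ _
  rw [P3.j, dualGen, inv_mul_mul_a, hW, hG, testCfg_ba]
  simp only [Ad_zero, P3.mul_u, P3.inv_u, hu, mul_inv_rev, Ad_mul, testCfg_u, inv_inv, add_zero,
    sub_sub_cancel, Ad_Ad_inv]

/-- In the Fox expansion over the dual generators only the term of `X` survives. -/
lemma mink_twistJ_dual (u : Gen g → L3) (x z : Word g)
    (hxz : wordProd (dualGen FreeGroup.of) x = wordProd FreeGroup.of z)
    (p v : Fin 3 → ℝ) (X : Gen g) :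
    mink v (twistJ u z p X) =
      mink (sideSum (dualGen u) x X p) (dualGen (testCfg u X v) X).j := by
  rw [mink_twistJ, ← wordProd_dualGen_eq _ x z hxz, mink_wordProd_j,
    Finset.sum_eq_single X (fun Y _ hY => by
      rw [dualGen_testCfg_j_of_ne u X Y v hY, mink_zero_right])
      (fun h => absurd (Finset.mem_univ _) h)]
  congr 2
  funext Y
  exact dualGen_u _ _

/-- The twist in terms of the dual generators. -/
lemma twistJ_a (u : Gen g → L3) (x z : Word g)
    (hxz : wordProd (dualGen FreeGroup.of) x = wordProd FreeGroup.of z)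
    (p : Fin 3 → ℝ) (i : Fin g) :
    twistJ u z p (.a i) = Ad (hProd u i) (sideSum (dualGen u) x (.a i) p) :=
  eq_of_forall_mink fun v => by
    rw [mink_twistJ_dual u x z hxz, dualGen_testCfg_j_a, mink_Ad_right, inv_inv, mink_comm]

lemma twistJ_b (u : Gen g → L3) (x z : Word g)
    (hxz : wordProd (dualGen FreeGroup.of) x = wordProd FreeGroup.of z)
    (p : Fin 3 → ℝ) (i : Fin g) :
    twistJ u z p (.b i) =
      -Ad ((u (.b i))⁻¹ * u (.a i) * hProd u i) (sideSum (dualGen u) x (.b i) p) :=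
  eq_of_forall_mink fun v => by
    rw [mink_twistJ_dual u x z hxz, dualGen_testCfg_j_b, mink_neg_right, mink_Ad_right, inv_inv,
      mink_neg_right, mink_comm]

end calculus

/-! ### Intersection points of a drawing -/

section lists

lemma sum_map_filterMap {α β A : Type*} [AddCommMonoid A] (f : α → Option β) (h : β → A)
    (l : List α) :
    ((l.filterMap f).map h).sum = (l.map fun k => (f k).elim 0 h).sum := by
  induction l with
  | nil => rfl
  | cons a l ih =>
    rw [List.filterMap_cons]
    cases hfa : f a <;> simp [hfa, ih]

/-- The heights of the segments only permute the summands, so they have no effect on sums of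
translations. -/
lemma sum_map_perm_finRange {A : Type*} [AddCommMonoid A] {n : ℕ} (e : Fin n ≃ Fin n)
    (f : Fin n → A) : (((List.finRange n).map e).map f).sum = ∑ k, f k := by
  rw [((Equiv.Perm.map_finRange_perm e).map f).sum_eq, Fin.sum_univ_def]

lemma prod_reverse_flatMap {α M : Type*} [Monoid M] (B : α → List M) (l : List α) :
    (l.flatMap B).reverse.prod = (l.map fun j => (B j).reverse.prod).reverse.prod := by
  induction l with
  | nil => rfl
  | cons a l ih => simp [ih]

lemma sum_flatMap {α A : Type*} [AddCommMonoid A] (B : α → List A) (l : List α) :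
    (l.flatMap B).sum = (l.map fun j => (B j).sum).sum := by
  induction l with
  | nil => rfl
  | cons a l ih => simp [ih]

end lists

lemma wordProd_eq_finRange {g : ℕ} {G : Type*} [Group G] (f : Gen g → G) (y : Word g) :
    wordProd f y =
      ((List.finRange y.length).map fun j => letter f (y.get j)).reverse.prod := by
  have h : (List.finRange y.length).map (fun j => letter f (y.get j)) = y.map (letter f) := by
    rw [← List.ofFn_eq_map]
    conv_rhs => rw [← List.ofFn_get y, List.map_ofFn]
    rfl
  rw [h, wordProd]

namespace Drawing

variable {g : ℕ} {z y : Word g}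

lemma pos_inr_ne_pos_inl (d : Drawing z y) (j : Fin y.length) (k : Fin z.length) (e e' : Bool) :
    d.pos (.inr j) e ≠ d.pos (.inl k) e' := by
  intro h
  have := @d.pos_injective (.inr j, e) (.inl k, e') h
  simp at this

open Classical in
-- A vertical line meets a segment iff it separates its two ends, and the difference of the two
-- indicators "this end is to the left" is then the oriented intersection number. Ties cannot occur
-- because positions are distinct.
lemma sum_startCrossings {A : Type*} [AddCommGroup A] [Module ℝ A] (d : Drawing z y)
    (j : Fin y.length) (V : ℕ → ℕ → A) :
    ((d.startCrossings j).map fun q => (q.sign : ℝ) • V q.k q.l).sum =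
      ∑ k : Fin z.length,
        ((if d.startPos (.inr j) < d.endPos (.inl k) then V (k + 1) j else 0) -
          (if d.startPos (.inr j) < d.startPos (.inl (finRotate _ k)) then V (k + 1) j else 0)) := by
  rw [startCrossings, sum_map_filterMap, sum_map_perm_finRange]
  refine Finset.sum_congr rfl fun k _ => ?_
  have h1 : d.startPos (.inr j) ≠ d.endPos (.inl k) := d.pos_inr_ne_pos_inl _ _ _ _
  generalize finRotate z.length k = k'
  have h2 : d.startPos (.inr j) ≠ d.startPos (.inl k') := d.pos_inr_ne_pos_inl _ _ _ _
  rcases h1.lt_or_gt with h1 | h1 <;> rcases h2.lt_or_gt with h2 | h2 <;>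
    simp [h1, h2, h1.not_gt, h2.not_gt]

open Classical in
lemma sum_endCrossings {A : Type*} [AddCommGroup A] [Module ℝ A] (d : Drawing z y)
    (j : Fin y.length) (V : ℕ → ℕ → A) :
    ((d.endCrossings j).map fun q => (q.sign : ℝ) • V q.k q.l).sum =
      -∑ k : Fin z.length,
        ((if d.endPos (.inr j) < d.endPos (.inl k) then V (k + 1) (j + 1) else 0) -
          (if d.endPos (.inr j) < d.startPos (.inl (finRotate _ k)) then V (k + 1) (j + 1)
            else 0)) := by
  rw [endCrossings, List.filterMap_reverse, List.map_reverse, List.sum_reverse, sum_map_filterMap,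
    sum_map_perm_finRange, ← Finset.sum_neg_distrib]
  refine Finset.sum_congr rfl fun k _ => ?_
  have h1 : d.endPos (.inr j) ≠ d.endPos (.inl k) := d.pos_inr_ne_pos_inl _ _ _ _
  generalize finRotate z.length k = k'
  have h2 : d.endPos (.inr j) ≠ d.startPos (.inl k') := d.pos_inr_ne_pos_inl _ _ _ _
  rcases h1.lt_or_gt with h1 | h1 <;> rcases h2.lt_or_gt with h2 | h2 <;>
    simp [h1, h2, h1.not_gt, h2.not_gt]

/-- Handles the closing segment from the last strand of `λ` to the first, where the index wraps
around. -/
lemma finRotate_periodic {A : Type*} {n : ℕ} (V : ℕ → A) (hV : V n = V 0) (k : Fin n) :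
    V (finRotate n k) = V (k + 1) := by
  cases n with
  | zero => exact k.elim0
  | succ n =>
    rcases eq_or_ne k (Fin.last n) with rfl | hk
    · rw [finRotate_last]; simpa using hV.symm
    · rw [coe_finRotate_of_ne_last hk]

/-- The vector carried by the `k`-th strand of `λ`. -/
def strandVec (u : Gen g → L3) (z : Word g) (p : Fin 3 → ℝ) (k : Fin z.length) : Fin 3 → ℝ :=
  if (z.get k).2 then Ad (wordProd u (z.take k)) p else -Ad (wordProd u (z.take (k + 1))) p

lemma sideSum_eq_strandVec (u : Gen g → L3) (z : Word g) (p : Fin 3 → ℝ) (X : Gen g) :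
    sideSum u z X p = ∑ k, if (z.get k).1 = X then strandVec u z p k else 0 := rfl

lemma wordProd_take_succ {G : Type*} [Group G] (f : Gen g → G) (z : Word g) (k : Fin z.length) :
    wordProd f (z.take (k + 1)) = letter f (z.get k) * wordProd f (z.take k) := by
  rw [List.take_succ_eq_append_getElem k.2, wordProd_append]
  simp

open Classical in
/-- The sum of the crossings of a vertical line at the place `σ` with the segments of `λ`. -/
def lineSum (d : Drawing z y) (u : Gen g → L3) (p : Fin 3 → ℝ) (σ : ℝ) : Fin 3 → ℝ :=
  ∑ k : Fin z.length,
    ((if σ < d.pos (.inl k) true then Ad (u (z.get k).1) (strandVec u z p k) else 0) -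
      (if σ < d.pos (.inl k) false then strandVec u z p k else 0))

open Classical in
-- The sum over segments is regrouped by strands. Each segment carries one vector, shared by the
-- strand that ends there and the one that starts there; for the closing segment this uses that `p`
-- is fixed by the holonomy of `λ`. The sign in `strandVec` makes the contribution independent of
-- the direction of the strand.
lemma lineSum_eq (d : Drawing z y) (u : Gen g → L3) (p : Fin 3 → ℝ)
    (hp : Ad (wordProd u z) p = p) (σ : ℝ) :
    ∑ k : Fin z.length,
        ((if σ < d.endPos (.inl k) then Ad (wordProd u (z.take (k + 1))) p else 0) -
          (if σ < d.startPos (.inl (finRotate _ k)) then Ad (wordProd u (z.take (k + 1))) p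
            else 0)) = d.lineSum u p σ := by
  have hV : ∀ k : Fin z.length, Ad (wordProd u (z.take (finRotate _ k : Fin z.length))) p =
      Ad (wordProd u (z.take (k + 1))) p :=
    fun k => finRotate_periodic (fun k => Ad (wordProd u (z.take k)) p)
      (by simp [hp, Ad_one]) k
  have hr : ∑ k : Fin z.length, (if σ < d.startPos (.inl (finRotate _ k)) then
      Ad (wordProd u (z.take (k + 1))) p else 0) =
      ∑ k : Fin z.length, (if σ < d.startPos (.inl k) then Ad (wordProd u (z.take k)) p else 0) := by
    simp only [← hV]
    exact Equiv.sum_comp (finRotate _) fun k : Fin z.length =>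
      if σ < d.startPos (.inl k) then Ad (wordProd u (z.take k)) p else 0
  rw [Finset.sum_sub_distrib, hr, ← Finset.sum_sub_distrib, lineSum]
  refine Finset.sum_congr rfl fun k _ => ?_
  have hs := wordProd_take_succ u z k
  simp only [startPos, endPos, Sum.elim_inl, strandVec]
  rcases Bool.eq_false_or_eq_true (z.get k).2 with hb | hb
  rotate_left
  · have : Ad (u (z.get k).1) (Ad (wordProd u (z.take (k + 1))) p) =
        Ad (wordProd u (z.take k)) p := by
      rw [hs, Ad_mul, letter, hb]
      simp [Ad_Ad_inv]
    simp only [hb, Bool.not_false, Bool.false_eq_true, if_false, Ad_neg, this]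
    split_ifs <;> simp only [sub_neg_eq_add, sub_zero, zero_sub, zero_add, neg_add_eq_sub]
  · have : Ad (u (z.get k).1) (Ad (wordProd u (z.take k)) p) =
        Ad (wordProd u (z.take (k + 1))) p := by
      rw [hs, Ad_mul, letter, hb]
      simp
    simp only [hb, Bool.not_true, if_true, this]

lemma twistKer_sum {ι : Type*} (s : Finset ι) (u : Gen g → L3) (X Y : Gen g)
    (f : ι → Fin 3 → ℝ) : twistKer u X Y (∑ i ∈ s, f i) = ∑ i ∈ s, twistKer u X Y (f i) :=
  eq_of_forall_mink fun v => by simp only [mink_twistKer, mink_sum_left, mink_sum_right]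

lemma twistKer_zero (u : Gen g → L3) (X Y : Gen g) : twistKer u X Y 0 = 0 := by
  simp [twistKer, Ad_zero]

lemma twistJ_eq_strandVec (u : Gen g → L3) (z : Word g) (p : Fin 3 → ℝ) (X : Gen g) :
    twistJ u z p X = ∑ k, twistKer u X (z.get k).1 (strandVec u z p k) := by
  simp only [twistJ, sideSum_eq_strandVec, twistKer_sum]
  rw [Finset.sum_comm]
  refine Finset.sum_congr rfl fun k _ => ?_
  rw [Finset.sum_eq_single (z.get k).1 (fun Y _ hY => by rw [if_neg hY.symm, twistKer_zero])
    (fun h => absurd (Finset.mem_univ _) h), if_pos rfl]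

lemma rank_injective {X Y : Gen g} {e e' : Bool} (h : rank X e = rank Y e') : X = Y ∧ e = e' := by
  cases X <;> cases Y <;> cases e <;> cases e' <;> simp [rank] at h ⊢ <;> omega

lemma rank_false_lt_true (X : Gen g) : rank X false < rank X true := by
  cases X <;> simp [rank]

lemma pos_lt_pos_iff (d : Drawing z y) (j : Fin y.length) (k : Fin z.length) (e e' : Bool)
    (h : rank (y.get j).1 e ≠ rank (z.get k).1 e') :
    d.pos (.inr j) e < d.pos (.inl k) e' ↔ rank (y.get j).1 e < rank (z.get k).1 e' := by
  constructor
  · intro hlt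
    by_contra hn
    exact hlt.not_gt (d.pos_lt (.inl k) (.inr j) e' e (lt_of_le_of_ne (not_lt.mp hn) h.symm))
  · exact d.pos_lt (.inr j) (.inl k) e e'

/-- Each strand of `λ` contributes four indicators comparing its ends with the ends of the strand of
`η`. For different generators these are decided by `rank`; for equal ones the total does not depend
on which strand lies further left. -/
lemma Ad_lineSum (d : Drawing z y) (u : Gen g → L3) (p : Fin 3 → ℝ) (j : Fin y.length) :
    Ad (u (y.get j).1)⁻¹ (d.lineSum u p (d.pos (.inr j) true)) -
      d.lineSum u p (d.pos (.inr j) false) = twistJ u z p (y.get j).1 := by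
  classical
  rw [twistJ_eq_strandVec, lineSum, lineSum, Ad_sum, ← Finset.sum_sub_distrib]
  refine Finset.sum_congr rfl fun k _ => ?_
  have hpar := d.parallel (.inr j) (.inl k) (by simp)
  have hne := (d.pos_inr_ne_pos_inl j k true true)
  have hiff := d.pos_lt_pos_iff j k
  simp only [Sum.elim_inl, Sum.elim_inr] at hpar
  generalize strandVec u z p k = q at *
  generalize (y.get j).1 = X at *
  generalize (z.get k).1 = Y at *
  simp only [twistKer, Ad_sub, apply_ite (Ad (u X)⁻¹), Ad_zero, ← Ad_mul]
  have hft := hiff false true fun h => by simpa using (rank_injective h).2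
  have htf := hiff true false fun h => by simpa using (rank_injective h).2
  rw [if_congr hft rfl rfl, if_congr htf rfl rfl]
  -- In a common band exactly one of the two end-to-end comparisons holds, since the orders at `s_x`
  -- and `t_x` are opposite. Both possibilities contribute the same vector `q`; `twistKer` assigns
  -- it to the endpoints through its `≤`.
  by_cases hXY : X = Y
  · subst hXY
    specialize hpar rfl
    rw [if_pos le_rfl, if_neg (lt_irrefl _)]
    rcases hne.lt_or_gt with h | h
    · rw [if_pos h, if_neg (fun h' => h.not_gt (hpar.mp h'))]
      abel
    · rw [if_neg h.not_gt, if_pos (hpar.mpr h)]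
      simp [Ad_one]
      abel
  · have htt := hiff true true fun h => hXY (rank_injective h).1
    have hff := hiff false false fun h => hXY (rank_injective h).1
    have hle : rank X true ≤ rank Y true ↔ rank X true < rank Y true :=
      ⟨fun h => lt_of_le_of_ne h fun h => hXY (rank_injective h).1, le_of_lt⟩
    rw [if_congr htt rfl rfl, if_congr hff rfl rfl, if_congr hle rfl rfl]
    abel

/-- The intersection points near a factor of `η` contribute the value of the twist cocycle on that
factor. -/
lemma sum_crossings_letter (d : Drawing z y) (u : Gen g → L3) (p : Fin 3 → ℝ)
    (hp : Ad (wordProd u z) p = p) (j : Fin y.length) :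
    ((d.endCrossings j).map fun q => (q.sign : ℝ) • Ad (wordProd u (z.take q.k)) p).sum +
      Ad (letter u (y.get j))
        ((d.startCrossings j).map fun q => (q.sign : ℝ) • Ad (wordProd u (z.take q.k)) p).sum =
      (letter (fun X => P3.ofJ (u X) (twistJ u z p X)) (y.get j)).a := by
  rw [d.sum_endCrossings j fun k _ => Ad (wordProd u (z.take k)) p,
    d.sum_startCrossings j fun k _ => Ad (wordProd u (z.take k)) p,
    d.lineSum_eq u p hp, d.lineSum_eq u p hp]
  simp only [letter, startPos, endPos, Sum.elim_inr, ← d.Ad_lineSum]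
  cases (y.get j).2 <;> simp [Ad_sub, Ad_Ad_inv, Ad_inv_Ad] <;> abel

end Drawing

/-! ### The grafting map -/

/-- The translation by `v`. -/
def translation (v : Fin 3 → ℝ) : P3 := ⟨1, v⟩

lemma translation_mul (v w : Fin 3 → ℝ) :
    translation v * translation w = translation (v + w) :=
  P3.ext (mul_one 1) (by simp [translation, Ad_one])

lemma mul_translation_mul_inv (h : P3) (v : Fin 3 → ℝ) :
    h * translation v * h⁻¹ = translation (Ad h.u v) := by
  refine P3.ext (by simp [translation]) ?_
  simp [translation, Ad_neg, Ad_Ad_inv]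

lemma mul_translation (h : P3) (v : Fin 3 → ℝ) :
    h * translation v = translation (Ad h.u v) * h := by
  rw [← mul_translation_mul_inv, inv_mul_cancel_right]

lemma prod_reverse_translation {α : Type*} (f : α → Fin 3 → ℝ) (l : List α) :
    (l.map fun q => translation (f q)).reverse.prod = translation (l.map f).sum := by
  induction l with
  | nil => rfl
  | cons a l ih => simp [ih, translation_mul, add_comm]

section graft

variable {g : ℕ}

/-- The configuration with `j_X` replaced by `j_X + κ_X`. -/
def shiftJ (c : Config g) (κ : Gen g → Fin 3 → ℝ) : Config g :=
  fun X => P3.ofJ (c X).u ((c X).j + κ X)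

lemma letter_u (c : Config g) (l : Gen g × Bool) : (letter c l).u = letter (lor c) l :=
  (map_letter P3.uHom c l).symm

/-- A shift of `j_X` multiplies the holonomy from the left by a translation. Collected over both
exponents, these translations are the values of the cocycle with Lorentz parts `u` and vectors `κ`.
-/
lemma letter_shiftJ (c : Config g) (κ : Gen g → Fin 3 → ℝ) (l : Gen g × Bool) :
    letter (shiftJ c κ) l =
      translation (letter (fun X => P3.ofJ (lor c X) (κ X)) l).a * letter c l := by
  have h : shiftJ c κ l.1 = translation (-Ad (c l.1).u (κ l.1)) * c l.1 := by
    refine P3.ext (one_mul _).symm ?_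
    simp [shiftJ, translation, Ad_add, Ad_one, P3.j, Ad_neg, Ad_Ad_inv]
  unfold letter
  split_ifs
  · exact h
  · rw [h, mul_inv_rev]
    have : (translation (-Ad (c l.1).u (κ l.1)))⁻¹ = translation (Ad (c l.1).u (κ l.1)) := by
      rw [inv_eq_iff_mul_eq_one, translation_mul, neg_add_cancel]; rfl
    rw [this, mul_translation]
    simp [lor, Ad_neg]

/-- The translations inserted before a letter are moved past it, picking up its `Ad`, and merge with
those inserted after it. By `Drawing.sum_crossings_letter` the result is the value of the twist
cocycle on that letter. -/
lemma insertProd_translation {z y : Word g} (d : Drawing z y) (c : Config g) (p : Fin 3 → ℝ)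
    (hp : Ad (wordProd (lor c) z) p = p) (r : ℝ) :
    d.insertProd (letter c)
        (fun q => translation (r • (q.sign : ℝ) • Ad (wordProd (lor c) (z.take q.k)) p)) =
      wordProd (shiftJ c fun X => r • twistJ (lor c) z p X) y := by
  rw [Drawing.insertProd, prod_reverse_flatMap, wordProd_eq_finRange]
  congr 3
  funext j
  rw [List.reverse_append, List.reverse_append, List.prod_append, List.prod_append,
    prod_reverse_translation, prod_reverse_translation, List.reverse_singleton,
    List.prod_singleton, mul_translation, ← mul_assoc, translation_mul, letter_shiftJ]
  congr 2
  have hs : (letter (fun X => P3.ofJ (lor c X) (r • twistJ (lor c) z p X)) (y.get j)).a =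
      r • (letter (fun X => P3.ofJ (lor c X) (twistJ (lor c) z p X)) (y.get j)).a := by
    unfold letter
    split_ifs <;> simp [Ad_smul, Ad_neg]
  rw [hs, ← d.sum_crossings_letter (lor c) p hp j, letter_u, smul_add, ← Ad_smul,
    List.smul_sum, List.smul_sum, List.map_map, List.map_map]
  rfl

lemma wordProd_lor (c : Config g) (x : Word g) : (wordProd c x).u = wordProd (lor c) x :=
  wordProd_u c x

lemma graftTilde_eq {z y : Word g} (d : Drawing z y) (c : Config g)
    (hp : Ad (wordProd c z).u (pvec (wordProd c z).u) = pvec (wordProd c z).u) (w : ℝ) :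
    d.graftTilde w c =
      wordProd (shiftJ c fun X => -w • twistJ (lor c) z (pvec (wordProd c z).u) X) y := by
  rw [← insertProd_translation d c _ (by rw [← wordProd_lor]; exact hp), Drawing.graftTilde]
  congr 1
  funext q
  change _ * translation _ * _ = _
  rw [mul_translation_mul_inv, wordProd_lor, Ad_neg, Ad_smul, mul_smul, neg_smul]

/-- The grafting map is the shift of the vectors `j_X` by the twist along `λ`. -/
lemma graft_eq (v₀ : L3) (x z : Word g)
    (hxz : wordProd (dualGen FreeGroup.of) x = wordProd FreeGroup.of z) (c : Config g)
    (hm : mass (wordProd c z) ≠ 0) (w : ℝ) :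
    graft v₀ x (w * mass (wordProd c z)) c =
      shiftJ c fun X => -w • twistJ (lor c) z (pvec (wordProd c z).u) X := by
  have hph : phat (wordProd (dualGen c) x) =
      (1 / mass (wordProd c z)) • pvec (wordProd c z).u := by
    rw [wordProd_dualGen_eq c x z hxz, phat]
  -- The factor `m_λ` turns `p̂_λ` into `p_λ`, and conjugation by `v₀` comes out as a single `Ad
  -- v₀`.
  have hS : ∀ X, (w * mass (wordProd c z)) •
      sideSum (dualLor v₀ c) x X (-Ad v₀ (phat (wordProd (dualGen c) x))) =
      Ad v₀ (-w • sideSum (dualGen (lor c)) x X (pvec (wordProd c z).u)) := by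
    intro X
    have : dualLor v₀ c = fun X => v₀ * dualGen (lor c) X * v₀⁻¹ := rfl
    rw [hph, ← Ad_neg, this, sideSum_conj, sideSum_neg, sideSum_smul, ← Ad_smul, smul_neg,
      smul_smul, mul_assoc, mul_one_div_cancel hm, mul_one, neg_smul]
  -- With `W_i` the handle product of the original generators, this turns the prefactor `v₀⁻¹ (hProd
  -- v i)⁻¹` into `W_i v₀⁻¹`, whose `v₀⁻¹` cancels the `Ad v₀` found above.
  have hW : ∀ i, hProd (dualLor v₀ c) i = v₀ * (hProd (lor c) i)⁻¹ * v₀⁻¹ := by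
    intro i
    rw [← hProd_dualGen]
    exact map_hProd (MulAut.conj v₀).toMonoidHom (dualGen (lor c)) i
  funext X
  cases X with
  | a i =>
    simp only [graft, shiftJ]
    rw [← Ad_smul, hS, ← Ad_mul, hW, twistJ_a _ x z hxz, ← Ad_smul]
    congr 4
    group
  | b i =>
    simp only [graft, shiftJ]
    rw [← Ad_smul, hS, ← Ad_mul, hW, twistJ_b _ x z hxz, smul_neg, ← Ad_smul, ← sub_eq_add_neg]
    congr 3
    -- Up to conjugation by `v₀`, `v_{A_i}⁻¹ v_{B_i}` is `n_{a_i}⁻¹ n_{b_i} = W_i⁻¹ b_i⁻¹ a_i W_i`.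
    simp [dualLor, dualGen, mul_assoc]

end graft

/-! ### Poincaré elements as matrices over the dual numbers -/

lemma gen_smul_eps (v : Fin 3 → ℝ) :
    gen (fun b => (v b) • (DualNumber.eps : DualNumber ℝ)) =
      (DualNumber.eps : DualNumber ℝ) • (gen v).map (algebraMap ℝ (DualNumber ℝ)) := by
  ext1 i j
  rw [gen_eq, gen_eq]
  fin_cases i <;> fin_cases j <;> simp [Algebra.smul_def, mul_comm]

lemma smul_eps_mul_smul_eps (M N : Matrix (Fin 3) (Fin 3) (DualNumber ℝ)) :
    ((DualNumber.eps : DualNumber ℝ) • M) * ((DualNumber.eps : DualNumber ℝ) • N) = 0 := by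
  rw [Matrix.smul_mul, Matrix.mul_smul, smul_smul, DualNumber.eps_mul_eps, zero_smul]

lemma toDual_eq (h : P3) :
    h.toDual = (1 + (DualNumber.eps : DualNumber ℝ) • (gen h.a).map (algebraMap ℝ (DualNumber ℝ))) *
      (lorMat h.u).map (algebraMap ℝ (DualNumber ℝ)) := by
  rw [P3.toDual, gen_smul_eps]

/-- Equivariance of `gen` moves the Lorentz part of `g` past the translation of `h`, and `θ² = 0`
kills the product of the two translation terms. -/
lemma toDual_mul (g h : P3) : (g * h).toDual = g.toDual * h.toDual := by
  have hc : (lorMat g.u).map (algebraMap ℝ (DualNumber ℝ)) *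
      (gen h.a).map (algebraMap ℝ (DualNumber ℝ)) =
      (gen (Ad g.u h.a)).map (algebraMap ℝ (DualNumber ℝ)) *
        (lorMat g.u).map (algebraMap ℝ (DualNumber ℝ)) := by
    rw [← Matrix.map_mul, ← Matrix.map_mul, gen_Ad_mul]
  simp only [toDual_eq, P3.mul_a, P3.mul_u, lorMat_mul, Matrix.map_mul, gen_add]
  rw [Matrix.map_add _ (map_add _), smul_add]
  generalize (lorMat g.u).map (algebraMap ℝ (DualNumber ℝ)) = U at *
  generalize (lorMat h.u).map (algebraMap ℝ (DualNumber ℝ)) = V at *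
  generalize (gen g.a).map (algebraMap ℝ (DualNumber ℝ)) = A at *
  generalize (gen h.a).map (algebraMap ℝ (DualNumber ℝ)) = B at *
  generalize (gen (Ad g.u h.a)).map (algebraMap ℝ (DualNumber ℝ)) = B' at *
  have h1 : U * ((DualNumber.eps : DualNumber ℝ) • B) = ((DualNumber.eps : DualNumber ℝ) • B') * U := by
    rw [Matrix.mul_smul, hc, Matrix.smul_mul]
  have h2 := smul_eps_mul_smul_eps A B'
  generalize (DualNumber.eps : DualNumber ℝ) • A = A at *
  generalize (DualNumber.eps : DualNumber ℝ) • B' = B' at *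
  generalize (DualNumber.eps : DualNumber ℝ) • B = B at *
  calc (1 + (A + B')) * (U * V) = (1 + A) * (1 + B') * (U * V) - (A * B') * (U * V) := by
        noncomm_ring
    _ = (1 + A) * (U + B' * U) * V := by rw [h2]; noncomm_ring
    _ = _ := by rw [← h1]; noncomm_ring

lemma toDual_one : (1 : P3).toDual = 1 := by
  simp [toDual_eq, gen_zero, lorMat_one]

/-- `P₃↑` as a monoid of matrices over the dual numbers. -/
def toDualHom : P3 →* Matrix (Fin 3) (Fin 3) (DualNumber ℝ) where
  toFun := P3.toDual
  map_one' := toDual_one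
  map_mul' := toDual_mul

lemma exp_of_mul_self_eq_zero (N : Matrix (Fin 3) (Fin 3) (DualNumber ℝ)) (h : N * N = 0) :
    NormedSpace.exp N = 1 + N := by
  rw [NormedSpace.exp_eq_tsum ℝ]
  have h2 : ∀ n ∉ Finset.range 2, ((n.factorial : ℝ)⁻¹) • N ^ n = 0 := by
    intro n hn
    obtain ⟨k, rfl⟩ := Nat.exists_eq_add_of_le' (not_lt.mp (Finset.mem_range.not.mp hn))
    rw [pow_add, sq, h, mul_zero, smul_zero]
  change ∑' n, ((n.factorial : ℝ)⁻¹) • N ^ n = _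
  rw [tsum_eq_sum h2]
  simp [Finset.sum_range_succ]

/-- The vector `k` is already multiplied by `θ`, so it disappears when the parameter is a multiple
of `θ`. No property of `kvec` is therefore needed. -/
lemma exp_eps_gen (p k : Fin 3 → ℝ) (w : ℝ) (s : ℤ) :
    NormedSpace.exp (-(((w • (DualNumber.eps : DualNumber ℝ)) * (s : DualNumber ℝ)) •
      gen (dualVec p k))) = (translation (-((w * (s : ℝ)) • p))).toDual := by
  have h : -(((w • (DualNumber.eps : DualNumber ℝ)) * (s : DualNumber ℝ)) • gen (dualVec p k)) =
      gen fun b => ((-((w * (s : ℝ)) • p)) b) • (DualNumber.eps : DualNumber ℝ) := by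
    rw [← gen_smul, ← gen_neg]
    congr 1
    funext b
    ext
    · simp [dualVec]
    · have : TrivSqZeroExt.fst (algebraMap ℝ (DualNumber ℝ) (p b)) = p b := rfl
      simp [dualVec, this, mul_assoc]
  rw [h, exp_of_mul_self_eq_zero _ (by rw [gen_smul_eps, smul_eps_mul_smul_eps])]
  simp [P3.toDual, translation, lorMat_one]

lemma map_insertProd {g : ℕ} {z y : Word g} {M N : Type*} [Monoid M] [Monoid N] (φ : M →* N)
    (d : Drawing z y) (Y : Gen g × Bool → M) (I : Crossing → M) :
    φ (d.insertProd Y I) = d.insertProd (fun l => φ (Y l)) fun q => φ (I q) := by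
  simp [Drawing.insertProd, map_list_prod, List.map_reverse, List.map_flatMap]
  rfl

lemma toDual_graftTilde {g : ℕ} {z y : Word g} (d : Drawing z y) (c : Config g) (w : ℝ) :
    (d.graftTilde w c).toDual = d.dehn (w • DualNumber.eps) c := by
  change toDualHom _ = _
  rw [Drawing.graftTilde, map_insertProd, Drawing.dehn]
  congr 1
  funext q
  rw [exp_eps_gen, map_mul, map_mul]
  rfl

/-! ### Hyperbolic elements -/

/-- The axial vector of a matrix: the coefficients of its `η`-antisymmetric part in the basis
`J_a`. -/
def axial (M : Matrix (Fin 3) (Fin 3) ℝ) : Fin 3 → ℝ :=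
  ![(M 1 2 - M 2 1) / 2, (M 0 2 + M 2 0) / 2, -(M 0 1 + M 1 0) / 2]

/-- The square of `gen p` is `η`-symmetric, so only the linear term is seen. This recovers `p` from
its exponential up to a known factor. -/
lemma axial_exp_form (p : Fin 3 → ℝ) (r s : ℝ) :
    axial (1 + r • gen p + s • (gen p * gen p)) = r • p := by
  rw [gen_eq]
  funext a
  fin_cases a <;> simp [axial] <;> ring

lemma trace_exp_form (p : Fin 3 → ℝ) (r s : ℝ) :
    (1 + r • gen p + s • (gen p * gen p)).trace = 3 - 2 * s * mink p p := by
  rw [gen_eq]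
  simp [Matrix.trace, Fin.sum_univ_three, mink, sgn]
  ring

lemma trace_gen_mul (ω : Fin 3 → ℝ) (M : Matrix (Fin 3) (Fin 3) ℝ) :
    (gen ω * M).trace = -2 * mink ω (axial M) := by
  rw [gen_eq]
  simp only [Matrix.trace, Matrix.diag, Matrix.mul_apply, Fin.sum_univ_three]
  simp [mink, sgn, axial, Fin.sum_univ_three]
  ring

lemma gen_mulVec_self (p : Fin 3 → ℝ) : gen p *ᵥ p = 0 := by
  rw [gen_eq]
  funext a
  fin_cases a <;> simp [Matrix.mulVec, dotProduct, Fin.sum_univ_three] <;> ring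

lemma gen_mul_gen_mul_gen (p : Fin 3 → ℝ) : gen p * gen p * gen p = (-mink p p) • gen p := by
  rw [gen_eq]
  ext i j
  fin_cases i <;> fin_cases j <;>
    simp [Matrix.mul_apply, Fin.sum_univ_three, mink, sgn] <;> ring

/-- The right side at `tA`, called `R`, solves `R' = A R`, so `e^{-tA} R(t)` is constant; comparing
`t = 1` with `t = 0` gives the formula. -/
lemma exp_of_cube_eq {𝔸 : Type*} [NormedRing 𝔸] [NormedAlgebra ℝ 𝔸] [CompleteSpace 𝔸] (A : 𝔸)
    (m : ℝ) (hm : m ≠ 0) (h3 : A * (A * A) = m ^ 2 • A) :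
    NormedSpace.exp A =
      1 + (Real.sinh m / m) • A + ((Real.cosh m - 1) / m ^ 2) • (A * A) := by
  let R : ℝ → 𝔸 := fun t =>
    1 + (Real.sinh (t * m) / m) • A + ((Real.cosh (t * m) - 1) / m ^ 2) • (A * A)
  have hR : ∀ t, HasDerivAt R (A * R t) t := by
    intro t
    have hl : HasDerivAt (fun t : ℝ => t * m) m t := by
      simpa using (hasDerivAt_id t).mul_const m
    have h1 : HasDerivAt (fun t : ℝ => (Real.sinh (t * m) / m) • A) (Real.cosh (t * m) • A) t := by
      have := ((hl.sinh).div_const m).smul_const A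
      simpa [hm] using this
    have h2 : HasDerivAt (fun t : ℝ => ((Real.cosh (t * m) - 1) / m ^ 2) • (A * A))
        ((Real.sinh (t * m) / m) • (A * A)) t := by
      have := (((hl.cosh).sub_const 1).div_const (m ^ 2)).smul_const (A * A)
      rwa [show Real.sinh (t * m) * m / m ^ 2 = Real.sinh (t * m) / m by field_simp] at this
    have := ((hasDerivAt_const t (1 : 𝔸)).add h1).add h2
    refine this.congr_deriv ?_
    simp only [R, mul_add, mul_one, mul_smul_comm, h3, smul_smul]
    rw [show (Real.cosh (t * m) - 1) / m ^ 2 * m ^ 2 = Real.cosh (t * m) - 1 by field_simp]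
    module
  have hE : ∀ t : ℝ, HasDerivAt (fun t : ℝ => NormedSpace.exp (t • (-A)) * R t) 0 t := by
    intro t
    refine ((hasDerivAt_exp_smul_const (-A) t).mul (hR t)).congr_deriv ?_
    rw [mul_neg, neg_mul, mul_assoc, neg_add_cancel]
  have hconst := is_const_of_deriv_eq_zero (fun t => (hE t).differentiableAt)
    (fun t => (hE t).deriv) 1 0
  have h0 : R 0 = 1 := by simp [R]
  have h1 : R 1 = 1 + (Real.sinh m / m) • A + ((Real.cosh m - 1) / m ^ 2) • (A * A) := by
    simp [R]
  simp only [one_smul, zero_smul, NormedSpace.exp_zero, h0, one_mul] at hconst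
  let _ : NormedAlgebra ℚ 𝔸 := NormedAlgebra.restrictScalars ℚ ℝ 𝔸
  rw [← h1, ← one_mul (R 1), ← show NormedSpace.exp A * NormedSpace.exp (-A) = 1 by
    rw [← NormedSpace.exp_add_of_commute (Commute.neg_right (Commute.refl A)), add_neg_cancel,
      NormedSpace.exp_zero], mul_assoc, hconst, mul_one]

section
open scoped Matrix.Norms.Operator

lemma exp_gen (p : Fin 3 → ℝ) (m : ℝ) (hm : m ≠ 0) (h : -mink p p = m ^ 2) :
    NormedSpace.exp (gen p) =
      1 + (Real.sinh m / m) • gen p + ((Real.cosh m - 1) / m ^ 2) • (gen p * gen p) :=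
  exp_of_cube_eq (gen p) m hm (by rw [← mul_assoc, gen_mul_gen_mul_gen, h])

end

lemma pvec_spec {u : L3} (h : IsHyperbolic u) :
    mink (pvec u) (pvec u) < 0 ∧ expL (-pvec u) = u := by
  rw [pvec, dif_pos h]
  exact h.choose_spec

lemma lorMat_expL_neg (p : Fin 3 → ℝ) (m : ℝ) (hm : m ≠ 0) (h : -mink p p = m ^ 2) :
    lorMat (expL (-p)) =
      1 + (-(Real.sinh m / m)) • gen p + ((Real.cosh m - 1) / m ^ 2) • (gen p * gen p) := by
  change NormedSpace.exp (gen (-p)) = _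
  rw [exp_gen (-p) m hm (by rw [mink_neg_left, mink_neg_right, neg_neg, h]), gen_neg]
  simp

section hyperbolic

variable {h : P3}

lemma mass_pos (hh : IsHyperbolic h.u) : 0 < mass h :=
  Real.sqrt_pos.mpr (by linarith [(pvec_spec hh).1])

lemma mass_sq (hh : IsHyperbolic h.u) : -mink (pvec h.u) (pvec h.u) = mass h ^ 2 :=
  (Real.sq_sqrt (by linarith [(pvec_spec hh).1])).symm

lemma lorMat_hyperbolic (hh : IsHyperbolic h.u) :
    lorMat h.u = 1 + (-(Real.sinh (mass h) / mass h)) • gen (pvec h.u) +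
      ((Real.cosh (mass h) - 1) / mass h ^ 2) • (gen (pvec h.u) * gen (pvec h.u)) := by
  rw [← lorMat_expL_neg _ _ (mass_pos hh).ne' (mass_sq hh), (pvec_spec hh).2]

lemma Ad_pvec (hh : IsHyperbolic h.u) : Ad h.u (pvec h.u) = pvec h.u := by
  rw [Ad, lorMat_hyperbolic hh]
  simp [Matrix.add_mulVec, Matrix.neg_mulVec, Matrix.smul_mulVec, ← Matrix.mulVec_mulVec, gen_mulVec_self]

lemma Ad_phat (hh : IsHyperbolic h.u) : Ad h.u (phat h) = phat h := by
  rw [phat, Ad_smul, Ad_pvec hh]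

lemma trace_hyperbolic (hh : IsHyperbolic h.u) :
    (lorMat h.u).trace = 1 + 2 * Real.cosh (mass h) := by
  rw [lorMat_hyperbolic hh, trace_exp_form, ← neg_neg (mink _ _), mass_sq hh]
  have := (mass_pos hh).ne'
  field_simp
  ring

lemma trace_gt_three (hh : IsHyperbolic h.u) : 3 < (lorMat h.u).trace := by
  have := Real.one_lt_cosh.mpr (mass_pos hh).ne'
  rw [trace_hyperbolic hh]
  linarith

/-- The vector `pvec` is obtained by choice. This formula and `phat_eq` express mass and direction
through the matrix alone, and so make them accessible to differentiation. -/
lemma mass_eq (hh : IsHyperbolic h.u) : mass h = Real.arcosh (((lorMat h.u).trace - 1) / 2) := by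
  rw [trace_hyperbolic hh]
  rw [show (1 + 2 * Real.cosh (mass h) - 1) / 2 = Real.cosh (mass h) by ring,
    Real.arcosh_cosh (mass_pos hh).le]

lemma sinh_mass (hh : IsHyperbolic h.u) :
    Real.sinh (mass h) = √((((lorMat h.u).trace - 1) / 2) ^ 2 - 1) := by
  rw [mass_eq hh, Real.sinh_arcosh (by linarith [trace_gt_three hh])]

lemma axial_hyperbolic (hh : IsHyperbolic h.u) :
    axial (lorMat h.u) = -(Real.sinh (mass h)) • phat h := by
  rw [lorMat_hyperbolic hh, axial_exp_form, phat, smul_smul]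
  congr 1
  ring

lemma phat_eq (hh : IsHyperbolic h.u) :
    phat h = -(√((((lorMat h.u).trace - 1) / 2) ^ 2 - 1))⁻¹ • axial (lorMat h.u) := by
  have h0 : Real.sinh (mass h) ≠ 0 := (Real.sinh_pos_iff.mpr (mass_pos hh)).ne'
  rw [axial_hyperbolic hh, ← sinh_mass hh, smul_smul, neg_mul_neg, inv_mul_cancel₀ h0, one_smul]

end hyperbolic

lemma spin_eq (h : P3) : spin h = mink (phat h) h.j := by
  rw [spin, phat, mink_smul_left]
  ring

/-! ### The trace criterion for hyperbolicity -/

lemma mul_self_eq_of_adjugate (M : Matrix (Fin 3) (Fin 3) ℝ) :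
    M * M = M.trace • M - M.adjugate.trace • 1 + M.adjugate := by
  rw [Matrix.adjugate_fin_three]
  ext i j
  fin_cases i <;> fin_cases j <;>
    simp [Matrix.mul_apply, Matrix.trace, Fin.sum_univ_three] <;> ring

lemma trace_lorMat_inv (u : L3) : (lorMat u⁻¹).trace = (lorMat u).trace := by
  rw [lorMat_inv, Matrix.trace_mul_comm, ← Matrix.mul_assoc, etaMat_mul_self, Matrix.one_mul,
    Matrix.trace_transpose]

lemma gen_axial (u : L3) : (2 : ℝ) • gen (axial (lorMat u)) = lorMat u - lorMat u⁻¹ := by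
  rw [gen_eq]
  ext i j
  fin_cases i <;> fin_cases j <;>
    simp [axial, lorMat_inv_apply, sgn] <;> ring

/-- With `τ = tr u`, Cayley–Hamilton for `u` and `u⁻¹` gives `(u - u⁻¹)² = (τ + 1)(u + u⁻¹ - 2)`.
Thus the `η`-symmetric part of `u` is determined by its `η`-antisymmetric part, which is the axial
one. -/
lemma lorMat_eq_axial (u : L3) (h : (lorMat u).trace + 1 ≠ 0) :
    lorMat u = 1 + gen (axial (lorMat u)) +
      (2 / ((lorMat u).trace + 1)) • (gen (axial (lorMat u)) * gen (axial (lorMat u))) := by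
  have h1 := mul_self_eq_of_adjugate (lorMat u)
  have h2 := mul_self_eq_of_adjugate (lorMat u⁻¹)
  rw [adjugate_lorMat, trace_lorMat_inv] at h1
  rw [adjugate_lorMat, trace_lorMat_inv, inv_inv] at h2
  have h3 : (4 : ℝ) • (gen (axial (lorMat u)) * gen (axial (lorMat u))) =
      ((lorMat u).trace + 1) • (lorMat u + lorMat u⁻¹ - 2 • 1) := by
    calc _ = (2 : ℝ) • gen (axial (lorMat u)) * (2 : ℝ) • gen (axial (lorMat u)) := by
          rw [Matrix.smul_mul, Matrix.mul_smul, smul_smul]; norm_num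
      _ = lorMat u * lorMat u + lorMat u⁻¹ * lorMat u⁻¹ - lorMat u * lorMat u⁻¹ -
          lorMat u⁻¹ * lorMat u := by rw [gen_axial]; noncomm_ring
      _ = _ := by
          rw [h1, h2, lorMat_mul_inv, lorMat_inv_mul]
          module
  have h4 : (2 / ((lorMat u).trace + 1)) • (gen (axial (lorMat u)) * gen (axial (lorMat u))) =
      (1 / 2 : ℝ) • (lorMat u + lorMat u⁻¹ - 2 • 1) := by
    calc _ = (1 / (2 * ((lorMat u).trace + 1))) •
          ((4 : ℝ) • (gen (axial (lorMat u)) * gen (axial (lorMat u)))) := by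
          rw [smul_smul]; congr 1; field_simp; norm_num
      _ = _ := by rw [h3, smul_smul]; congr 1; field_simp
  have h5 : gen (axial (lorMat u)) = (1 / 2 : ℝ) • (lorMat u - lorMat u⁻¹) := by
    rw [← gen_axial, smul_smul]; norm_num
  rw [h4, h5]
  module

/-- The quadratic expression of `u` in its axial vector is matched with the closed form of the
exponential. As the condition is open, hyperbolicity persists under small perturbations. -/
lemma isHyperbolic_of_trace {u : L3} (h : 3 < (lorMat u).trace) : IsHyperbolic u := by
  set τ := (lorMat u).trace with hτ
  set a := axial (lorMat u) with ha
  have hu := lorMat_eq_axial u (by linarith)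
  rw [← hτ, ← ha] at hu
  have htr : τ = 3 - 2 * (2 / (τ + 1)) * mink a a := by
    have := trace_exp_form a 1 (2 / (τ + 1))
    rwa [one_smul, ← hu, ← hτ] at this
  have hτ1 : τ + 1 ≠ 0 := by linarith
  -- A hyperbolic element of mass `m` has trace `1 + 2 cosh m` and axial vector `-(sinh m / m) p`.
  -- This forces both `m` and the witness `-(m / sinh m) a` used below.
  set m := Real.arcosh ((τ - 1) / 2) with hm
  have hmpos : 0 < m := Real.arcosh_pos (by linarith)
  have hcosh : Real.cosh m = (τ - 1) / 2 := Real.cosh_arcosh (by linarith)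
  have hsinh : 0 < Real.sinh m := Real.sinh_pos_iff.mpr hmpos
  have hcs := Real.cosh_sq m
  have haa : -mink a a = Real.sinh m ^ 2 := by
    have : Real.sinh m ^ 2 = (τ - 3) * (τ + 1) / 4 := by rw [hcosh] at hcs; linarith
    rw [this]
    field_simp at htr
    linarith
  have hp : -mink (-(m / Real.sinh m) • a) (-(m / Real.sinh m) • a) = m ^ 2 := by
    rw [mink_smul_left, mink_smul_right]
    calc _ = (m / Real.sinh m) ^ 2 * (-mink a a) := by ring
      _ = m ^ 2 := by rw [haa]; field_simp
  refine ⟨-(m / Real.sinh m) • a, by nlinarith, ?_⟩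
  apply Subtype.ext
  apply Subtype.ext
  change lorMat (expL _) = lorMat u
  rw [lorMat_expL_neg _ m hmpos.ne' hp, hu, gen_smul, Matrix.smul_mul, Matrix.mul_smul, smul_smul,
    smul_smul, smul_smul]
  congr 2
  · rw [show -(Real.sinh m / m) * -(m / Real.sinh m) = 1 by field_simp, one_smul]
  · have : Real.cosh m + 1 = (τ + 1) / 2 := by rw [hcosh]; ring
    have h2 : Real.sinh m ^ 2 = (Real.cosh m - 1) * (Real.cosh m + 1) := by linear_combination -hcs
    have h3 : 0 < Real.cosh m + 1 := by rw [this]; linarith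
    have h4 : 0 < τ + 1 := by linarith
    rw [mul_assoc, neg_mul_neg, ← sq, div_pow, h2, show 2 / (τ + 1) = 1 / (Real.cosh m + 1) by
      rw [this]; field_simp]
    have h5 : Real.cosh m - 1 ≠ 0 := fun h0 => by
      rw [h0, zero_mul] at h2; exact (pow_pos hsinh 2).ne' h2
    field_simp

/-! ### Smoothness of holonomies in the exponential chart -/

section exp

lemma contDiff_exp_algebra {𝔸 : Type*} [NormedRing 𝔸] [NormedAlgebra ℝ 𝔸] [CompleteSpace 𝔸]
    {n : WithTop ℕ∞} : ContDiff ℝ n (NormedSpace.exp : 𝔸 → 𝔸) :=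
  AnalyticOnNhd.contDiff fun x _ => NormedSpace.exp_analytic x

variable {𝔸 E : Type*} [NormedRing 𝔸] [NormedAlgebra ℝ 𝔸] [FiniteDimensional ℝ 𝔸]
  [NormedAddCommGroup E] [NormedSpace ℝ E]

/-- Composing with `φ` makes the statement real-valued, so a norm on the matrix algebra is needed
only locally. -/
lemma contDiff_apply_exp [FiniteDimensional ℝ E] (L : E →ₗ[ℝ] 𝔸) (φ : 𝔸 →ₗ[ℝ] ℝ) {n : WithTop ℕ∞} :
    ContDiff ℝ n fun q => φ (NormedSpace.exp (L q)) := by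
  have : CompleteSpace 𝔸 := FiniteDimensional.complete ℝ 𝔸
  exact (LinearMap.toContinuousLinearMap φ).contDiff.comp
    (contDiff_exp_algebra.comp (LinearMap.toContinuousLinearMap L).contDiff)

lemma hasDerivAt_apply_exp (L : E →ₗ[ℝ] 𝔸) (φ : 𝔸 →ₗ[ℝ] ℝ) (q : E) :
    HasDerivAt (fun t : ℝ => φ (NormedSpace.exp (L (t • q)))) (φ (L q)) 0 := by
  have : CompleteSpace 𝔸 := FiniteDimensional.complete ℝ 𝔸
  have h := (LinearMap.toContinuousLinearMap φ).hasFDerivAt.comp_hasDerivAt (0 : ℝ)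
    (hasDerivAt_exp_smul_const (L q) (0 : ℝ))
  simpa [Function.comp_def] using h

end exp

/-- `p ↦ p^a J_a` as a linear map. -/
def genLin : (Fin 3 → ℝ) →ₗ[ℝ] Matrix (Fin 3) (Fin 3) ℝ where
  toFun := gen
  map_add' := gen_add
  map_smul' := gen_smul

section
open scoped Matrix.Norms.Operator

lemma contDiff_lorMat_expL (a b : Fin 3) :
    ContDiff ℝ 2 fun q : Fin 3 → ℝ => lorMat (expL q) a b :=
  contDiff_apply_exp (𝔸 := Matrix (Fin 3) (Fin 3) ℝ) genLin (Matrix.entryLinearMap ℝ ℝ a b)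

lemma hasDerivAt_lorMat_expL (q : Fin 3 → ℝ) (a b : Fin 3) :
    HasDerivAt (fun t : ℝ => lorMat (expL (t • q)) a b) (gen q a b) 0 :=
  hasDerivAt_apply_exp (𝔸 := Matrix (Fin 3) (Fin 3) ℝ) genLin (Matrix.entryLinearMap ℝ ℝ a b) q

end

lemma expL_zero : expL 0 = 1 := by
  apply Subtype.ext
  apply Subtype.ext
  change NormedSpace.exp (gen 0) = 1
  rw [gen_zero, NormedSpace.exp_zero]

/-! ### Holonomies and their derivatives in the exponential chart -/

section chart

variable {g : ℕ}

lemma lor_chart (c : Config g) (e : Tangent g) (X : Gen g) :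
    lor (chart c e) X = expL (e X).1 * lor c X := rfl

lemma chart_j (c : Config g) (e : Tangent g) (X : Gen g) :
    (chart c e X).j = (c X).j + (e X).2 := P3.ofJ_j _ _

lemma chart_zero (c : Config g) : chart c 0 = c := by
  funext X
  simp [chart, expL_zero, P3.ofJ_self]

lemma lift_u (f : Gen g → P3) (γ : FreeGroup (Gen g)) :
    (FreeGroup.lift f γ).u = FreeGroup.lift (fun X => (f X).u) γ := by
  have : P3.uHom.comp (FreeGroup.lift f) = FreeGroup.lift fun X => (f X).u := by
    ext1 X; simp
  exact DFunLike.congr_fun this γ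

/-- The Lorentz component of the holonomy of `γ`, as a function on the chart centred at `c`. -/
def lorHol (c : Config g) (γ : FreeGroup (Gen g)) (e : Tangent g) : L3 :=
  FreeGroup.lift (lor (chart c e)) γ

lemma lorHol_one (c : Config g) (e : Tangent g) : lorHol c 1 e = 1 := map_one _

lemma lorHol_of (c : Config g) (X : Gen g) (e : Tangent g) :
    lorHol c (FreeGroup.of X) e = expL (e X).1 * lor c X := FreeGroup.lift_apply_of

lemma lorHol_mul (c : Config g) (γ γ' : FreeGroup (Gen g)) (e : Tangent g) :
    lorHol c (γ * γ') e = lorHol c γ e * lorHol c γ' e := map_mul _ _ _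

lemma lorHol_inv (c : Config g) (γ : FreeGroup (Gen g)) (e : Tangent g) :
    lorHol c γ⁻¹ e = (lorHol c γ e)⁻¹ := map_inv _ _

lemma lorHol_zero (c : Config g) (γ : FreeGroup (Gen g)) :
    lorHol c γ 0 = FreeGroup.lift (lor c) γ := by rw [lorHol, chart_zero]

lemma lorHol_add_vertical (c : Config g) (γ : FreeGroup (Gen g)) (e V : Tangent g)
    (hV : ∀ X, (V X).1 = 0) : lorHol c γ (e + V) = lorHol c γ e := by
  have : lor (chart c (e + V)) = lor (chart c e) := by
    funext X
    rw [lor_chart, lor_chart, Pi.add_apply, Prod.fst_add, hV, add_zero]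
  rw [lorHol, lorHol, this]

/-- Twice differentiable, because `Θ` contains first derivatives of these functions and `Ω`
differentiates once more. -/
lemma contDiff_lorHol (c : Config g) (γ : FreeGroup (Gen g)) (a b : Fin 3) :
    ContDiff ℝ 2 fun e : Tangent g => lorMat (lorHol c γ e) a b := by
  induction γ using FreeGroup.induction_on generalizing a b with
  | C1 => simpa only [lorHol_one] using contDiff_const
  | of X =>
    simp only [lorHol_of, lorMat_mul, Matrix.mul_apply]
    refine ContDiff.sum fun k _ => ContDiff.mul ?_ contDiff_const
    exact (contDiff_lorMat_expL a k).comp (contDiff_fst.comp (contDiff_apply ℝ _ X))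
  | inv_of X h =>
    simp only [lorHol_inv, lorMat_inv_apply]
    exact (contDiff_const.mul (h b a)).mul contDiff_const
  | mul γ γ' h h' =>
    simp only [lorHol_mul, lorMat_mul, Matrix.mul_apply]
    exact ContDiff.sum fun k _ => (h a k).mul (h' k b)

lemma differentiable_lorHol (c : Config g) (γ : FreeGroup (Gen g)) (a b : Fin 3) :
    Differentiable ℝ fun e : Tangent g => lorMat (lorHol c γ e) a b :=
  (contDiff_lorHol c γ a b).differentiable (by norm_num)

/-- The cocycle `(δu_γ) u_γ⁻¹` of a tangent vector. -/
def velocity (c : Config g) (ξ : Tangent g) (γ : FreeGroup (Gen g)) : Fin 3 → ℝ :=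
  (FreeGroup.lift (fun X => (⟨lor c X, (ξ X).1⟩ : P3)) γ).a

lemma velocity_one (c : Config g) (ξ : Tangent g) : velocity c ξ 1 = 0 := by
  simp [velocity]

lemma velocity_of (c : Config g) (ξ : Tangent g) (X : Gen g) :
    velocity c ξ (FreeGroup.of X) = (ξ X).1 := by
  simp [velocity]

lemma velocity_mul (c : Config g) (ξ : Tangent g) (γ γ' : FreeGroup (Gen g)) :
    velocity c ξ (γ * γ') =
      velocity c ξ γ + Ad (FreeGroup.lift (lor c) γ) (velocity c ξ γ') := by
  simp [velocity, lift_u]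

lemma velocity_inv (c : Config g) (ξ : Tangent g) (γ : FreeGroup (Gen g)) :
    velocity c ξ γ⁻¹ = -Ad (FreeGroup.lift (lor c) γ)⁻¹ (velocity c ξ γ) := by
  simp [velocity, lift_u]

lemma velocity_add_smul (c : Config g) (r : ℝ) (ξ ξ' : Tangent g) (γ : FreeGroup (Gen g)) :
    velocity c (r • ξ + ξ') γ = r • velocity c ξ γ + velocity c ξ' γ := by
  induction γ using FreeGroup.induction_on with
  | C1 => simp [velocity_one]
  | of X => simp [velocity_of]
  | inv_of X h =>
    rw [velocity_inv, velocity_inv, velocity_inv, h, Ad_add, Ad_smul]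
    module
  | mul γ γ' h h' =>
    rw [velocity_mul, velocity_mul, velocity_mul, h, h', Ad_add, Ad_smul]
    module

/-- The product rule for `(δu) u⁻¹` is the multiplication of `L₃↑ ⋉ so(2,1)`, which is the Poincaré
group again; hence the velocity is the translation part of a word in Poincaré elements. -/
lemma hasDerivAt_lorHol (c : Config g) (ξ : Tangent g) (γ : FreeGroup (Gen g)) (a b : Fin 3) :
    HasDerivAt (fun t : ℝ => lorMat (lorHol c γ (t • ξ)) a b)
      ((gen (velocity c ξ γ) * lorMat (FreeGroup.lift (lor c) γ)) a b) 0 := by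
  induction γ using FreeGroup.induction_on generalizing a b with
  | C1 =>
    simp only [lorHol_one, velocity_one, gen_zero, Matrix.zero_mul]
    exact hasDerivAt_const _ _
  | of X =>
    simp only [lorHol_of, lorMat_mul, Matrix.mul_apply, velocity_of, FreeGroup.lift_apply_of]
    exact HasDerivAt.fun_sum fun k _ => (hasDerivAt_lorMat_expL (ξ X).1 a k).mul_const _
  | inv_of X h =>
    simp only [lorHol_inv, lorMat_inv_apply]
    refine (((h b a).const_mul _).mul_const _).congr_deriv ?_
    rw [velocity_inv, map_inv, gen_neg, Matrix.neg_mul, gen_Ad_mul]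
    generalize FreeGroup.lift (lor c) (FreeGroup.of X) = u
    generalize velocity c ξ (FreeGroup.of X) = v
    rw [gen_eq]
    fin_cases a <;> fin_cases b <;>
      simp [Matrix.mul_apply, Fin.sum_univ_three, lorMat_inv_apply, sgn] <;> ring
  | mul γ γ' h h' =>
    simp only [lorHol_mul, lorMat_mul, Matrix.mul_apply]
    refine (HasDerivAt.fun_sum fun k _ => (h a k).fun_mul (h' k b)).congr_deriv ?_
    simp only [zero_smul, lorHol_zero, Finset.sum_add_distrib, ← Matrix.mul_apply]
    rw [velocity_mul, gen_add, map_mul, lorMat_mul, Matrix.add_mul, Matrix.add_apply,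
      ← Matrix.mul_assoc, ← Matrix.mul_assoc, ← Matrix.mul_assoc, gen_Ad_mul]

lemma fderiv_lorHol (c : Config g) (ξ : Tangent g) (γ : FreeGroup (Gen g)) (a b : Fin 3) :
    fderiv ℝ (fun e : Tangent g => lorMat (lorHol c γ e) a b) 0 ξ =
      (gen (velocity c ξ γ) * lorMat (FreeGroup.lift (lor c) γ)) a b := by
  rw [← (differentiable_lorHol c γ a b 0).lineDeriv_eq_fderiv, lineDeriv]
  simp only [zero_add]
  exact (hasDerivAt_lorHol c ξ γ a b).deriv

/-! ### Logarithmic derivatives and the symplectic potential -/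

/-- The logarithmic derivative of the Lorentz component of the holonomy of `γ`. -/
def holDeriv (γ : FreeGroup (Gen g)) (c : Config g) (e ξ : Tangent g) :
    Matrix (Fin 3) (Fin 3) ℝ :=
  logDeriv (fun c => FreeGroup.lift (lor c) γ) c e ξ

lemma holDeriv_apply (γ : FreeGroup (Gen g)) (c : Config g) (e ξ : Tangent g) (a b : Fin 3) :
    holDeriv γ c e ξ a b = ∑ k, fderiv ℝ (fun e => lorMat (lorHol c γ e) a k) e ξ *
      lorMat (lorHol c γ⁻¹ e) k b := by
  rw [lorHol_inv]
  rfl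

lemma differentiable_holDeriv (γ : FreeGroup (Gen g)) (c : Config g) (ξ : Tangent g)
    (a b : Fin 3) : Differentiable ℝ fun e => holDeriv γ c e ξ a b := by
  simp only [holDeriv_apply]
  refine Differentiable.fun_sum fun k _ => Differentiable.fun_mul ?_ (differentiable_lorHol c _ k b)
  have h : ContDiff ℝ 1 (fderiv ℝ fun e => lorMat (lorHol c γ e) a k) :=
    (contDiff_lorHol c γ a k).fderiv_right (by norm_num)
  exact (h.clm_apply contDiff_const).differentiable (by norm_num)

lemma holDeriv_zero (γ : FreeGroup (Gen g)) (c : Config g) (ξ : Tangent g) :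
    holDeriv γ c 0 ξ = gen (velocity c ξ γ) := by
  ext1 a b
  simp only [holDeriv_apply, fderiv_lorHol]
  rw [← Matrix.mul_apply, lorHol_inv, lorHol_zero, Matrix.mul_assoc, lorMat_mul_inv, Matrix.mul_one]

/-- The Lorentz parts do not depend on the `j`-coordinates, so moving along these changes neither
the functions nor their derivatives. -/
lemma holDeriv_vertical_point (γ : FreeGroup (Gen g)) (c : Config g) (V ξ : Tangent g)
    (hV : ∀ X, (V X).1 = 0) : holDeriv γ c V ξ = holDeriv γ c 0 ξ := by
  ext1 a b
  have h : ∀ k, fderiv ℝ (fun e => lorMat (lorHol c γ e) a k) V =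
      fderiv ℝ (fun e => lorMat (lorHol c γ e) a k) 0 := by
    intro k
    have := fderiv_comp_add_right (𝕜 := ℝ) (f := fun e => lorMat (lorHol c γ e) a k)
      (x := 0) V
    simpa only [lorHol_add_vertical c γ _ V hV, zero_add] using this.symm
  have h2 := lorHol_add_vertical c γ⁻¹ 0 V hV
  rw [zero_add] at h2
  simp only [holDeriv_apply, h, h2]

lemma holDeriv_vertical (γ : FreeGroup (Gen g)) (c : Config g) (e V : Tangent g)
    (hV : ∀ X, (V X).1 = 0) : holDeriv γ c e V = 0 := by
  ext1 a b
  rw [holDeriv_apply]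
  refine Finset.sum_eq_zero fun k _ => ?_
  rw [← (differentiable_lorHol c γ a k e).lineDeriv_eq_fderiv, lineDeriv]
  have : ∀ t : ℝ, lorHol c γ (e + t • V) = lorHol c γ e :=
    fun t => lorHol_add_vertical c γ e (t • V) fun X => by simp [hV]
  simp [this]

lemma holDeriv_add_smul (γ : FreeGroup (Gen g)) (c : Config g) (e : Tangent g) (r : ℝ)
    (ξ ξ' : Tangent g) :
    holDeriv γ c e (r • ξ + ξ') = r • holDeriv γ c e ξ + holDeriv γ c e ξ' := by
  ext1 a b
  rw [Matrix.add_apply, Matrix.smul_apply]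
  simp only [holDeriv_apply, map_add, map_smul, smul_eq_mul, add_mul, Finset.sum_add_distrib,
    Finset.mul_sum, mul_assoc]

lemma pairing_add_smul_right (r : ℝ) (j : Fin 3 → ℝ) (M N : Matrix (Fin 3) (Fin 3) ℝ) :
    pairing j (r • M + N) = r * pairing j M + pairing j N := by
  simp [pairing, Matrix.mul_add]; ring

lemma pairing_zero_right (j : Fin 3 → ℝ) : pairing j 0 = 0 := by simp [pairing]

lemma differentiable_pairing {j : Tangent g → Fin 3 → ℝ}
    {M : Tangent g → Matrix (Fin 3) (Fin 3) ℝ} (hj : ∀ a, Differentiable ℝ fun e => j e a)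
    (hM : ∀ a b, Differentiable ℝ fun e => M e a b) :
    Differentiable ℝ fun e => pairing (j e) (M e) := by
  simp only [pairing, trace_gen_mul, axial, mink, Fin.sum_univ_three]
  simp only [Matrix.cons_val_zero, Matrix.cons_val_one, Matrix.cons_val]
  fun_prop

variable (g) in
/-- The elements `W_i = h_{i-1} ⋯ h_1`, `a_i⁻¹ b_i⁻¹ a_i W_i` and `b_i⁻¹ a_i W_i` that enter the
symplectic potential. -/
def potElt : Fin 3 → Fin g → FreeGroup (Gen g)
  | 0, i => hProd FreeGroup.of i
  | 1, i => (FreeGroup.of (.a i))⁻¹ * (FreeGroup.of (.b i))⁻¹ * FreeGroup.of (.a i) *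
      hProd FreeGroup.of i
  | 2, i => (FreeGroup.of (.b i))⁻¹ * FreeGroup.of (.a i) * hProd FreeGroup.of i

lemma lift_potElt_zero {G : Type*} [Group G] (f : Gen g → G) (i : Fin g) :
    FreeGroup.lift f (potElt g 0 i) = hProd f i := by
  rw [hProd_eq_lift]; rfl

lemma lift_potElt_one {G : Type*} [Group G] (f : Gen g → G) (i : Fin g) :
    FreeGroup.lift f (potElt g 1 i) = (f (.a i))⁻¹ * (f (.b i))⁻¹ * f (.a i) * hProd f i := by
  rw [hProd_eq_lift]; simp [potElt]

lemma lift_potElt_two {G : Type*} [Group G] (f : Gen g → G) (i : Fin g) :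
    FreeGroup.lift f (potElt g 2 i) = (f (.b i))⁻¹ * f (.a i) * hProd f i := by
  rw [hProd_eq_lift]; simp [potElt]

lemma theta_eq (c : Config g) (e ξ : Tangent g) :
    theta c e ξ = ∑ i : Fin g,
      (pairing ((c (.a i)).j + (e (.a i)).2) (holDeriv (potElt g 0 i) c e ξ)
        - pairing ((c (.a i)).j + (e (.a i)).2) (holDeriv (potElt g 1 i) c e ξ)
        + pairing ((c (.b i)).j + (e (.b i)).2) (holDeriv (potElt g 1 i) c e ξ)
        - pairing ((c (.b i)).j + (e (.b i)).2) (holDeriv (potElt g 2 i) c e ξ)) := by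
  simp only [theta, holDeriv, chart_j, lift_potElt_zero, lift_potElt_one, lift_potElt_two]

lemma differentiable_theta (c : Config g) (ξ : Tangent g) :
    Differentiable ℝ fun e => theta c e ξ := by
  simp only [theta_eq]
  have hj : ∀ (X : Gen g) (γ : FreeGroup (Gen g)),
      Differentiable ℝ fun e : Tangent g => pairing ((c X).j + (e X).2) (holDeriv γ c e ξ) :=
    fun X γ => differentiable_pairing
      (fun a => by
        simp only [Pi.add_apply]
        fun_prop)
      fun a b => differentiable_holDeriv γ c ξ a b
  exact Differentiable.fun_sum fun i _ =>
    (((hj _ _).sub (hj _ _)).add (hj _ _)).sub (hj _ _)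

lemma theta_add_smul (c : Config g) (e : Tangent g) (r : ℝ) (ξ ξ' : Tangent g) :
    theta c e (r • ξ + ξ') = r * theta c e ξ + theta c e ξ' := by
  simp only [theta_eq, holDeriv_add_smul, pairing_add_smul_right, Finset.mul_sum,
    ← Finset.sum_add_distrib]
  exact Finset.sum_congr rfl fun i _ => by ring

lemma theta_vertical (c : Config g) (e V : Tangent g) (hV : ∀ X, (V X).1 = 0) :
    theta c e V = 0 := by
  simp [theta_eq, holDeriv_vertical _ c e V hV, pairing_zero_right]

/-- The coframe dual to the vectors `j_X`. -/
def coframe (c : Config g) (ξ : Tangent g) : Gen g → Fin 3 → ℝ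
  | .a i => velocity c ξ (potElt g 0 i) - velocity c ξ (potElt g 1 i)
  | .b i => velocity c ξ (potElt g 1 i) - velocity c ξ (potElt g 2 i)

lemma sum_gen {A : Type*} [AddCommMonoid A] (f : Gen g → A) :
    ∑ X, f X = ∑ i, (f (.a i) + f (.b i)) := by
  have hb : Function.Bijective (Sum.elim Gen.a Gen.b : Fin g ⊕ Fin g → Gen g) := by
    constructor
    · rintro (i | i) (k | k) h <;> simp_all
    · rintro (i | i)
      · exact ⟨.inl i, rfl⟩
      · exact ⟨.inr i, rfl⟩
  rw [Finset.sum_add_distrib, ← hb.sum_comp, Fintype.sum_sum_type]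
  rfl

/-- `Θ` vanishes identically on vectors without Lorentz part, so one term of `δΘ` drops out. In the
other, `Θ` is affine along `V`, and its slope pairs `V` with the coframe. -/
lemma omega_vertical_left (c : Config g) (V ξ : Tangent g) (hV : ∀ X, (V X).1 = 0) :
    omega c V ξ = ∑ X, mink (V X).2 (coframe c ξ X) := by
  have h0 : (fun e => theta c e V) = fun _ => 0 := funext fun e => theta_vertical c e V hV
  rw [omega, h0, ← (differentiable_theta c ξ 0).lineDeriv_eq_fderiv, lineDeriv]
  have h1 : ∀ t : ℝ, theta c (0 + t • V) ξ =
      theta c 0 ξ + t * ∑ X, mink (V X).2 (coframe c ξ X) := by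
    intro t
    have ht : ∀ γ, holDeriv γ c (t • V) ξ = gen (velocity c ξ γ) := fun γ => by
      rw [holDeriv_vertical_point γ c (t • V) ξ fun X => by simp [hV], holDeriv_zero]
    simp only [theta_eq, zero_add, ht, holDeriv_zero, pairing_gen, sum_gen, Finset.mul_sum,
      ← Finset.sum_add_distrib]
    refine Finset.sum_congr rfl fun i _ => ?_
    simp only [coframe, mink_sub_right, mink_add_left, Pi.smul_apply, Prod.smul_snd,
      mink_smul_left, Pi.zero_apply, Prod.snd_zero, mink_zero_left]
    ring
  simp only [h1, fderiv_const_apply, zero_apply, sub_zero]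
  simp

lemma omega_swap (c : Config g) (ξ ζ : Tangent g) : omega c ξ ζ = -omega c ζ ξ := by
  simp [omega]

lemma omega_add_smul_left (c : Config g) (r : ℝ) (ξ ξ' ζ : Tangent g) :
    omega c (r • ξ + ξ') ζ = r * omega c ξ ζ + omega c ξ' ζ := by
  have h : fderiv ℝ (fun e => theta c e (r • ξ + ξ')) 0 =
      r • fderiv ℝ (fun e => theta c e ξ) 0 + fderiv ℝ (fun e => theta c e ξ') 0 := by
    simp only [theta_add_smul]
    rw [fderiv_fun_add ((differentiable_theta c ξ 0).const_mul r) (differentiable_theta c ξ' 0),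
      fderiv_const_mul (differentiable_theta c ξ 0)]
  rw [omega, omega, omega, h]
  simp
  ring

end chart

section symplectic

variable {g : ℕ}

/-! ### Nondegeneracy of the symplectic form -/

/-- If the velocity vanishes on `W_i`, vanishing coframe components make it vanish on the other two
elements of `potElt`. The letters `a_i` and `b_i` are quotients of products of these. -/
lemma velocity_eq_zero_of_coframe {c : Config g} {ξ : Tangent g} {i : Fin g}
    (ha : coframe c ξ (.a i) = 0) (hb : coframe c ξ (.b i) = 0)
    (hW : velocity c ξ (hProd FreeGroup.of i) = 0) : (ξ (.a i)).1 = 0 ∧ (ξ (.b i)).1 = 0 := by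
  have h0 : velocity c ξ (potElt g 0 i) = 0 := hW
  have h1 : velocity c ξ (potElt g 1 i) = 0 := by
    rw [coframe, h0, zero_sub, neg_eq_zero] at ha; exact ha
  have h2 : velocity c ξ (potElt g 2 i) = 0 := by
    rw [coframe, h1, zero_sub, neg_eq_zero] at hb; exact hb
  have e1 : FreeGroup.of (.a i) * potElt g 1 i = potElt g 2 i := by simp [potElt, mul_assoc]
  have e2 : FreeGroup.of (.b i) * potElt g 2 i = FreeGroup.of (.a i) * potElt g 0 i := by
    simp [potElt, mul_assoc]
  have ha' : (ξ (.a i)).1 = 0 := by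
    have := congrArg (velocity c ξ) e1
    rwa [velocity_mul, h1, h2, Ad_zero, add_zero, velocity_of] at this
  refine ⟨ha', ?_⟩
  have := congrArg (velocity c ξ) e2
  rwa [velocity_mul, velocity_mul, h2, h0, Ad_zero, Ad_zero, add_zero, add_zero, velocity_of,
    velocity_of, ha'] at this

lemma coframe_eq_zero {c : Config g} {ξ : Tangent g} (h : coframe c ξ = 0) (X : Gen g) :
    (ξ X).1 = 0 := by
  have hW : ∀ i : Fin g, velocity c ξ (hProd FreeGroup.of i) = 0 := by
    refine hProd_induction FreeGroup.of (fun _ W => velocity c ξ W = 0) (velocity_one c ξ) ?_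
    intro i hi
    obtain ⟨ha, hb⟩ := velocity_eq_zero_of_coframe (congrFun h _) (congrFun h _) hi
    simp [hElt, velocity_mul, velocity_inv, velocity_of, ha, hb, hi, Ad_zero]
  cases X with
  | a i => exact (velocity_eq_zero_of_coframe (congrFun h _) (congrFun h _) (hW i)).1
  | b i => exact (velocity_eq_zero_of_coframe (congrFun h _) (congrFun h _) (hW i)).2

lemma coframe_add_smul (c : Config g) (r : ℝ) (ξ ξ' : Tangent g) :
    coframe c (r • ξ + ξ') = r • coframe c ξ + coframe c ξ' := by
  funext X
  cases X <;> simp only [coframe, velocity_add_smul, Pi.add_apply, Pi.smul_apply] <;> module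

/-- The coframe on horizontal tangent vectors, as a linear endomorphism. -/
def coframeLin (c : Config g) : (Gen g → Fin 3 → ℝ) →ₗ[ℝ] (Gen g → Fin 3 → ℝ) where
  toFun ω := coframe c fun X => (ω X, 0)
  map_add' ω ω' := by
    have := coframe_add_smul c 1 (fun X => (ω X, 0)) (fun X => (ω' X, 0))
    rw [one_smul, one_smul] at this
    rw [← this]
    congr 1
    funext X
    simp
  map_smul' r ω := by
    have h0 : coframe c 0 = 0 := by
      have := coframe_add_smul c 1 0 0
      simpa using this
    have := coframe_add_smul c r (fun X => (ω X, 0)) 0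
    rw [h0, add_zero, add_zero] at this
    simp only [RingHom.id_apply]
    rw [← this]
    congr 1
    funext X
    simp

lemma coframe_surjective (c : Config g) : Function.Surjective (coframeLin c) := by
  refine LinearMap.injective_iff_surjective.mp ((injective_iff_map_eq_zero _).mpr fun ω h => ?_)
  funext X
  exact coframe_eq_zero (ξ := fun X => (ω X, 0)) h X

/-- In the splitting into Lorentz and `j`-parts, `Ω` is zero on the `j`-block, and its mixed block
is the coframe, which is invertible. -/
lemma omega_nondegenerate (c : Config g) (V : Tangent g) (h : ∀ ζ, omega c V ζ = 0) : V = 0 := by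
  have hV : ∀ X, (V X).1 = 0 := by
    -- Pairing with pure `j`-vectors supported at one generator kills the coframe of `V`, hence its
    -- Lorentz part.
    refine coframe_eq_zero (c := c) (funext fun X₀ => eq_of_forall_mink fun v => ?_)
    have hK := omega_vertical_left c (Pi.single X₀ (0, v)) V fun X => by
      by_cases hX : X = X₀
      · subst hX; simp
      · simp [hX]
    rw [omega_swap, h, Finset.sum_eq_single X₀ (fun X _ hX => by simp [hX, mink_zero_left])
      (fun h => absurd (Finset.mem_univ _) h)] at hK
    simpa [mink_zero_right] using hK.symm
  funext X₀
  refine Prod.ext (hV X₀) (eq_of_forall_mink fun v => ?_)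
  -- Now `V` has only a `j`-part, which is isolated by a vector whose coframe is concentrated at
  -- `X₀`.
  obtain ⟨ω, hω⟩ := coframe_surjective c (Pi.single X₀ v)
  have hK := omega_vertical_left c V (fun X => (ω X, 0)) hV
  rw [h, show (coframe c fun X => (ω X, 0)) = Pi.single X₀ v from hω,
    Finset.sum_eq_single X₀ (fun X _ hX => by simp [hX, mink_zero_right])
      (fun h => absurd (Finset.mem_univ _) h), Pi.single_eq_same] at hK
  rw [mink_comm, ← hK, Pi.zero_apply, Prod.snd_zero, mink_zero_right]

/-- The symplectic form as a bilinear form. -/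
def omegaLin (c : Config g) : Tangent g →ₗ[ℝ] Module.Dual ℝ (Tangent g) :=
  LinearMap.mk₂ ℝ (omega c)
    (fun ξ ξ' ζ => by simpa using omega_add_smul_left c 1 ξ ξ' ζ)
    (fun r ξ ζ => by
      have h0 := omega_add_smul_left c 1 0 0 ζ
      have := omega_add_smul_left c r ξ 0 ζ
      simp_all)
    (fun ξ ζ ζ' => by
      have := omega_add_smul_left c 1 ζ ζ' ξ
      rw [omega_swap c ξ, omega_swap c ξ, omega_swap c ξ]
      rw [one_smul] at this
      rw [this]
      ring)
    (fun r ξ ζ => by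
      have h0 := omega_add_smul_left c 1 0 0 ξ
      have := omega_add_smul_left c r ζ 0 ξ
      rw [omega_swap c ξ, omega_swap c ξ]
      simp_all)

lemma exists_hamiltonian (c : Config g) (φ : Tangent g →L[ℝ] ℝ) :
    ∃ V : Tangent g, ∀ ζ, omega c V ζ = φ ζ := by
  have hinj : Function.Injective (omegaLin c) :=
    (injective_iff_map_eq_zero _).mpr fun V h =>
      omega_nondegenerate c V fun ζ => DFunLike.congr_fun h ζ
  have hsurj := (LinearMap.injective_iff_surjective_of_finrank_eq_finrank
    (Subspace.dual_finrank_eq (K := ℝ) (V := Tangent g)).symm).mp hinj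
  obtain ⟨V, hV⟩ := hsurj φ.toLinearMap
  exact ⟨V, fun ζ => DFunLike.congr_fun hV ζ⟩

/-! ### The dual generators generate the free group -/

lemma wordProd_reverse_inv {G : Type*} [Group G] (f : Gen g → G) (x : Word g) :
    wordProd f (x.reverse.map fun l => (l.1, !l.2)) = (wordProd f x)⁻¹ := by
  induction x with
  | nil => simp
  | cons l x ih =>
    rw [List.reverse_cons, List.map_append, wordProd_append, ih, wordProd_cons, mul_inv_rev]
    congr 1
    cases h : l.2 <;> simp [letter, h]

/-- Given `W_i` in the subgroup, multiplying it by `n_{a_i}⁻¹` and then by `n_{b_i}` produces the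
other elements of `potElt`, from which `a_i` and `b_i` are recovered. The next `W` follows, so the
handles are treated inductively. -/
lemma of_mem_closure_dualGen (S : Subgroup (FreeGroup (Gen g)))
    (hS : ∀ X, dualGen FreeGroup.of X ∈ S) (X : Gen g) : FreeGroup.of X ∈ S := by
  have hstep : ∀ i : Fin g, hProd FreeGroup.of i ∈ S →
      FreeGroup.of (.a i) ∈ S ∧ FreeGroup.of (.b i) ∈ S := by
    intro i h0
    have h1 : potElt g 1 i ∈ S := by
      have : potElt g 1 i = hProd FreeGroup.of i * (dualGen FreeGroup.of (.a i))⁻¹ := by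
        simp [potElt, dualGen, hElt, mul_assoc]
      rw [this]
      exact S.mul_mem h0 (S.inv_mem (hS _))
    have h2 : potElt g 2 i ∈ S := by
      have : potElt g 2 i = potElt g 1 i * dualGen FreeGroup.of (.b i) := by
        simp [potElt, dualGen, hElt, mul_assoc]
      rw [this]
      exact S.mul_mem h1 (hS _)
    have ha : FreeGroup.of (.a i) ∈ S := by
      have : FreeGroup.of (.a i) = potElt g 2 i * (potElt g 1 i)⁻¹ := by
        simp [potElt, mul_assoc]
      rw [this]
      exact S.mul_mem h2 (S.inv_mem h1)
    refine ⟨ha, ?_⟩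
    have : FreeGroup.of (.b i) =
        FreeGroup.of (.a i) * hProd FreeGroup.of i * (potElt g 2 i)⁻¹ := by
      simp [potElt, mul_assoc]
    rw [this]
    exact S.mul_mem (S.mul_mem ha h0) (S.inv_mem h2)
  have hW : ∀ i : Fin g, hProd FreeGroup.of i ∈ S := by
    refine hProd_induction FreeGroup.of (fun _ W => W ∈ S) S.one_mem fun i hi => ?_
    obtain ⟨ha, hb⟩ := hstep i hi
    exact S.mul_mem (S.mul_mem (S.mul_mem (S.mul_mem hb (S.inv_mem ha)) (S.inv_mem hb)) ha) hi
  cases X with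
  | a i => exact (hstep i (hW i)).1
  | b i => exact (hstep i (hW i)).2

lemma exists_dual_word (γ : FreeGroup (Gen g)) :
    ∃ x : Word g, wordProd (dualGen FreeGroup.of) x = γ := by
  let S : Subgroup (FreeGroup (Gen g)) :=
    { carrier := Set.range (wordProd (dualGen FreeGroup.of))
      one_mem' := ⟨[], rfl⟩
      mul_mem' := by
        rintro _ _ ⟨x, rfl⟩ ⟨y, rfl⟩
        exact ⟨y ++ x, wordProd_append _ _ _⟩
      inv_mem' := by
        rintro _ ⟨x, rfl⟩
        exact ⟨_, wordProd_reverse_inv _ x⟩ }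
  have hof := of_mem_closure_dualGen S fun X => ⟨[(X, true)], by simp [letter]⟩
  change γ ∈ S
  induction γ using FreeGroup.induction_on with
  | C1 => exact S.one_mem
  | of X => exact hof X
  | inv_of X h => exact S.inv_mem h
  | mul γ γ' h h' => exact S.mul_mem h h'

/-! ### The Hamiltonian vector of the mass -/

lemma inv_mul_j (G H : P3) : (G⁻¹ * H).j = Ad H.u⁻¹ (G.a - H.a) := by
  simp [P3.j, Ad_mul, Ad_sub, Ad_add, Ad_neg, Ad_Ad_inv]
  abel

/-- The Hamiltonian vector of the mass of the curve with word `z`. -/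
def twistVec (c : Config g) (z : Word g) : Tangent g :=
  fun X => (0, twistJ (lor c) z (phat (wordProd c z)) X)

/-- The dual generators are quotients of consecutive elements of `potElt`, so a difference of
velocities becomes the vector `j` of a dual generator in the velocity cocycle. -/
lemma coframe_a (c : Config g) (ζ : Tangent g) (i : Fin g) :
    coframe c ζ (.a i) = -Ad (hProd (lor c) i)
      (dualGen (fun X => (⟨lor c X, (ζ X).1⟩ : P3)) (.a i)).j := by
  set f : Gen g → P3 := fun X => ⟨lor c X, (ζ X).1⟩ with hf
  have : dualGen f (.a i) =
      (FreeGroup.lift f (potElt g 1 i))⁻¹ * FreeGroup.lift f (potElt g 0 i) := by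
    rw [lift_potElt_zero, lift_potElt_one]
    simp [dualGen, hElt, mul_assoc]
  have hu : hProd (lor c) i = (FreeGroup.lift f (potElt g 0 i)).u := by
    rw [lift_u, lift_potElt_zero]
  rw [this, inv_mul_j, hu, Ad_Ad_inv, neg_sub]
  rfl

lemma coframe_b (c : Config g) (ζ : Tangent g) (i : Fin g) :
    coframe c ζ (.b i) = Ad ((lor c (.b i))⁻¹ * lor c (.a i) * hProd (lor c) i)
      (dualGen (fun X => (⟨lor c X, (ζ X).1⟩ : P3)) (.b i)).j := by
  set f : Gen g → P3 := fun X => ⟨lor c X, (ζ X).1⟩ with hf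
  have : dualGen f (.b i) =
      (FreeGroup.lift f (potElt g 1 i))⁻¹ * FreeGroup.lift f (potElt g 2 i) := by
    rw [lift_potElt_two, lift_potElt_one]
    simp [dualGen, hElt, mul_assoc]
  have hu : (lor c (.b i))⁻¹ * lor c (.a i) * hProd (lor c) i =
      (FreeGroup.lift f (potElt g 2 i)).u := by
    rw [lift_u, lift_potElt_two]
  rw [this, inv_mul_j, hu, Ad_Ad_inv]
  rfl

/-- Both `twistJ` and the coframe are `Ad`-images, by the same Lorentz element, of data at the dual
generators. Invariance of the Minkowski product leaves the Fox expansion of the velocity of `λ` in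
dual generators. -/
lemma omega_twistVec (c : Config g) (z : Word g) (hh : IsHyperbolic (wordProd c z).u)
    (ζ : Tangent g) :
    omega c (twistVec c z) ζ =
      mink (phat (wordProd c z)) (velocity c ζ (wordProd FreeGroup.of z)) := by
  obtain ⟨x, hx⟩ := exists_dual_word (wordProd FreeGroup.of z)
  rw [omega_vertical_left c _ ζ fun X => rfl]
  have hp := Ad_phat hh
  set p := phat (wordProd c z) with hpdef
  set f : Gen g → P3 := fun X => ⟨lor c X, (ζ X).1⟩ with hf
  have hu : (wordProd f z).u = (wordProd c z).u := by rw [wordProd_u, wordProd_u]; rfl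
  -- As `p̂` is fixed by the holonomy, pairing with the translation part or with `j` differs only by
  -- a sign.
  have hpi : Ad (wordProd f z).u⁻¹ p = p := by
    conv_lhs => rw [hu, ← hp, Ad_inv_Ad]
  have hv : mink p (velocity c ζ (wordProd FreeGroup.of z)) = -mink p (wordProd f z).j := by
    rw [velocity, ← wordProd_eq_lift, P3.a_eq, mink_neg_right, mink_Ad_right, hpi]
  have hN : (fun X => (dualGen f X).u) = dualGen (lor c) := funext fun X => dualGen_u f X
  rw [hv, ← wordProd_dualGen_eq f x z hx, mink_wordProd_j, hN, sum_gen, sum_gen,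
    ← Finset.sum_neg_distrib]
  refine Finset.sum_congr rfl fun i _ => ?_
  simp only [twistVec, ← hpdef, twistJ_a (lor c) x z hx, twistJ_b (lor c) x z hx, coframe_a,
    coframe_b, ← hf, mink_neg_left, mink_neg_right, mink_Ad_Ad]
  ring

/-! ### Derivatives of mass and spin -/

lemma wordProd_chart_u (c : Config g) (e : Tangent g) (z : Word g) :
    (wordProd (chart c e) z).u = lorHol c (wordProd FreeGroup.of z) e := by
  rw [wordProd_lor, wordProd_eq_lift, lorHol]

/-- The trace of the Lorentz component of a holonomy. -/
def traceHol (c : Config g) (γ : FreeGroup (Gen g)) (e : Tangent g) : ℝ :=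
  (lorMat (lorHol c γ e)).trace

lemma differentiable_traceHol (c : Config g) (γ : FreeGroup (Gen g)) :
    Differentiable ℝ (traceHol c γ) := by
  unfold traceHol Matrix.trace
  exact Differentiable.fun_sum fun k _ => differentiable_lorHol c γ k k

lemma fderiv_traceHol (c : Config g) (γ : FreeGroup (Gen g)) (ζ : Tangent g) :
    fderiv ℝ (traceHol c γ) 0 ζ =
      -2 * mink (velocity c ζ γ) (axial (lorMat (FreeGroup.lift (lor c) γ))) := by
  rw [← trace_gen_mul]
  unfold traceHol Matrix.trace
  simp only [Matrix.diag_apply]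
  rw [fderiv_fun_sum fun k _ => differentiable_lorHol c γ k k 0]
  simp only [sum_apply, fderiv_lorHol]

lemma traceHol_zero (c : Config g) (z : Word g) :
    traceHol c (wordProd FreeGroup.of z) 0 = (lorMat (wordProd c z).u).trace := by
  rw [traceHol, ← wordProd_chart_u, chart_zero]

lemma eventually_hyperbolic (c : Config g) (z : Word g) (hh : IsHyperbolic (wordProd c z).u) :
    ∀ᶠ e in nhds (0 : Tangent g), IsHyperbolic (wordProd (chart c e) z).u := by
  have hc := (differentiable_traceHol c (wordProd FreeGroup.of z)).continuous.continuousAt (x := 0)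
  have h0 := trace_gt_three hh
  rw [← traceHol_zero] at h0
  filter_upwards [hc.eventually (lt_mem_nhds h0)] with e he
  rw [wordProd_chart_u]
  exact isHyperbolic_of_trace he

lemma hasFDerivAt_mass (c : Config g) (z : Word g) (hh : IsHyperbolic (wordProd c z).u) :
    HasFDerivAt ((fun c' => mass (wordProd c' z)) ∘ chart c)
      ((Real.sinh (mass (wordProd c z)))⁻¹ •
        ((1 / 2 : ℝ) • fderiv ℝ (traceHol c (wordProd FreeGroup.of z)) 0)) 0 := by
  have hT := (differentiable_traceHol c (wordProd FreeGroup.of z) 0).hasFDerivAt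
  have hT2 : HasFDerivAt (fun e => (traceHol c (wordProd FreeGroup.of z) e - 1) / 2)
      ((1 / 2 : ℝ) • fderiv ℝ (traceHol c (wordProd FreeGroup.of z)) 0) 0 := by
    have := (hT.sub_const 1).const_mul (1 / 2 : ℝ)
    refine this.congr_of_eventuallyEq (Filter.Eventually.of_forall fun e => ?_)
    simp only
    ring
  have h3 := trace_gt_three hh
  have ha : HasDerivAt Real.arcosh (Real.sinh (mass (wordProd c z)))⁻¹
      ((traceHol c (wordProd FreeGroup.of z) 0 - 1) / 2) := by
    rw [sinh_mass hh, traceHol_zero]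
    exact Real.hasDerivAt_arcosh (by rw [Set.mem_Ioi]; linarith)
  refine (ha.comp_hasFDerivAt (0 : Tangent g) hT2).congr_of_eventuallyEq ?_
  filter_upwards [eventually_hyperbolic c z hh] with e he
  simp only [Function.comp_apply]
  rw [mass_eq he, wordProd_chart_u]
  rfl

/-- The derivative of the trace pairs the velocity with the axial vector `-(sinh m) p̂`, and the
derivative of `arcosh` divides by `sinh m`. -/
lemma fderiv_mass (c : Config g) (z : Word g) (hh : IsHyperbolic (wordProd c z).u)
    (ζ : Tangent g) :
    fderiv ℝ ((fun c' => mass (wordProd c' z)) ∘ chart c) 0 ζ =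
      mink (phat (wordProd c z)) (velocity c ζ (wordProd FreeGroup.of z)) := by
  have h0 : Real.sinh (mass (wordProd c z)) ≠ 0 := (Real.sinh_pos_iff.mpr (mass_pos hh)).ne'
  rw [(hasFDerivAt_mass c z hh).fderiv]
  simp only [smul_apply, fderiv_traceHol, smul_eq_mul]
  rw [← wordProd_eq_lift, ← wordProd_lor, axial_hyperbolic hh, mink_smul_right, mink_comm]
  field_simp

lemma differentiable_hol_a (c : Config g) (γ : FreeGroup (Gen g)) (b : Fin 3) :
    Differentiable ℝ fun e : Tangent g => (FreeGroup.lift (chart c e) γ).a b := by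
  have hu : ∀ (γ : FreeGroup (Gen g)) (e : Tangent g),
      (FreeGroup.lift (chart c e) γ).u = lorHol c γ e := fun γ e => lift_u _ _
  induction γ using FreeGroup.induction_on generalizing b with
  | C1 => simp
  | of X =>
    have h : ∀ e, (FreeGroup.lift (chart c e) (FreeGroup.of X)).a b =
        -∑ k, lorMat (lorHol c (FreeGroup.of X) e) b k * ((c X).j k + (e X).2 k) := by
      intro e
      rw [FreeGroup.lift_apply_of, P3.a_eq, chart_j, lorHol_of]
      rfl
    simp only [h]
    refine (Differentiable.fun_sum fun k _ => (differentiable_lorHol c _ b k).fun_mul ?_).fun_neg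
    fun_prop
  | inv_of X h =>
    have h' : ∀ e, (FreeGroup.lift (chart c e) (FreeGroup.of X)⁻¹).a b =
        -∑ k, lorMat (lorHol c (FreeGroup.of X)⁻¹ e) b k *
          (FreeGroup.lift (chart c e) (FreeGroup.of X)).a k := by
      intro e
      rw [map_inv, P3.inv_a, hu, lorHol_inv]
      rfl
    simp only [h']
    exact (Differentiable.fun_sum fun k _ => (differentiable_lorHol c _ b k).fun_mul (h k)).fun_neg
  | mul γ γ' h h' =>
    have h'' : ∀ e, (FreeGroup.lift (chart c e) (γ * γ')).a b =
        (FreeGroup.lift (chart c e) γ).a b + ∑ k, lorMat (lorHol c γ e) b k *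
          (FreeGroup.lift (chart c e) γ').a k := by
      intro e
      rw [map_mul, P3.mul_a, hu]
      rfl
    simp only [h'']
    exact (h b).fun_add
      (Differentiable.fun_sum fun k _ => (differentiable_lorHol c _ b k).fun_mul (h' k))

lemma differentiable_hol_j (c : Config g) (z : Word g) (b : Fin 3) :
    Differentiable ℝ fun e : Tangent g => (wordProd (chart c e) z).j b := by
  have h : ∀ e, (wordProd (chart c e) z).j b =
      -∑ k, lorMat (lorHol c (wordProd FreeGroup.of z)⁻¹ e) b k *
        (FreeGroup.lift (chart c e) (wordProd FreeGroup.of z)).a k := by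
    intro e
    rw [P3.j, wordProd_chart_u, ← lorHol_inv, ← wordProd_eq_lift]
    rfl
  simp only [h]
  exact (Differentiable.fun_sum fun k _ =>
    (differentiable_lorHol c _ b k).fun_mul (differentiable_hol_a c _ k)).fun_neg

/-- Near the base point `p̂` may be replaced by its explicit expression in trace and axial vector,
so the choice in `pvec` plays no role. -/
lemma differentiableAt_spin (c : Config g) (z : Word g) (hh : IsHyperbolic (wordProd c z).u) :
    DifferentiableAt ℝ ((fun c' => spin (wordProd c' z)) ∘ chart c) 0 := by
  have hev : ((fun c' => spin (wordProd c' z)) ∘ chart c) =ᶠ[nhds 0] fun e =>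
      -(√(((traceHol c (wordProd FreeGroup.of z) e - 1) / 2) ^ 2 - 1))⁻¹ *
        mink (axial (lorMat (lorHol c (wordProd FreeGroup.of z) e)))
          (wordProd (chart c e) z).j := by
    filter_upwards [eventually_hyperbolic c z hh] with e he
    simp only [Function.comp_apply]
    rw [spin_eq, phat_eq he, mink_smul_left, wordProd_chart_u]
    rfl
  refine DifferentiableAt.congr_of_eventuallyEq ?_ hev
  have h3 := trace_gt_three hh
  rw [← traceHol_zero] at h3
  have hT := differentiable_traceHol c (wordProd FreeGroup.of z) 0
  have hpos : 0 < ((traceHol c (wordProd FreeGroup.of z) 0 - 1) / 2) ^ 2 - 1 := by nlinarith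
  refine DifferentiableAt.fun_mul (DifferentiableAt.fun_neg (DifferentiableAt.fun_inv
    (DifferentiableAt.sqrt (by fun_prop) hpos.ne') (Real.sqrt_pos.mpr hpos).ne')) ?_
  have hj := fun b => differentiable_hol_j c z b
  have hU := fun a b => differentiable_lorHol c (wordProd FreeGroup.of z) a b
  simp only [axial, mink, Fin.sum_univ_three]
  simp only [Matrix.cons_val_zero, Matrix.cons_val_one, Matrix.cons_val]
  fun_prop

lemma phat_congr {h h' : P3} (hu : h.u = h'.u) : phat h = phat h' := by
  rw [phat, phat, mass, mass, hu]

/-- Along `V` all Lorentz parts stay fixed, so `p̂` is constant and the spin is affine in the `j_X`.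
-/
lemma fderiv_spin_vertical (c : Config g) (z : Word g) (hh : IsHyperbolic (wordProd c z).u)
    (V : Tangent g) (hV : ∀ X, (V X).1 = 0) :
    fderiv ℝ ((fun c' => spin (wordProd c' z)) ∘ chart c) 0 V =
      ∑ X, mink (sideSum (lor c) z X (phat (wordProd c z))) (V X).2 := by
  rw [← (differentiableAt_spin c z hh).lineDeriv_eq_fderiv, lineDeriv]
  have h : ∀ t : ℝ, ((fun c' => spin (wordProd c' z)) ∘ chart c) (0 + t • V) =
      ∑ X, mink (sideSum (lor c) z X (phat (wordProd c z))) (c X).j +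
        t * ∑ X, mink (sideSum (lor c) z X (phat (wordProd c z))) (V X).2 := by
    intro t
    have hl : lor (chart c (t • V)) = lor c := by
      funext X
      rw [lor_chart, Pi.smul_apply, Prod.smul_fst, hV, smul_zero, expL_zero, one_mul]
    have hu : (wordProd (chart c (t • V)) z).u = (wordProd c z).u := by
      rw [wordProd_lor, wordProd_lor, hl]
    rw [zero_add, Function.comp_apply, spin_eq, phat_congr hu, mink_wordProd_j]
    change ∑ X, mink (sideSum (lor (chart c (t • V))) z X _) _ = _
    rw [hl, Finset.mul_sum, ← Finset.sum_add_distrib]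
    refine Finset.sum_congr rfl fun X _ => ?_
    rw [chart_j, mink_add_right, Pi.smul_apply, Prod.smul_snd, mink_smul_right]
  simp only [h]
  simp

/-! ### The brackets -/

/-- An expansion by letters instead of generators, matching the grouping of the intersection points
along `η`. The prefix includes the letter itself because its translation part acts after its Lorentz
part. -/
lemma neg_mink_wordProd_j (f : Gen g → P3) (y : Word g) (p : Fin 3 → ℝ) :
    -mink p (wordProd f y).j = ∑ j : Fin y.length,
      mink (Ad (wordProd (fun X => (f X).u) (y.take (j + 1))) p) (letter f (y.get j)).a := by
  induction y generalizing p with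
  | nil => simp [P3.one_j, mink_zero_right]
  | cons l y ih =>
    have hl : (letter f l).u = letter (fun X => (f X).u) l := (map_letter P3.uHom f l).symm
    refine Eq.trans ?_ (Fin.sum_univ_succ (n := y.length) _).symm
    have := ih (Ad (letter (fun X => (f X).u) l) p)
    simp only [← Ad_mul] at this
    simp only [List.take_succ_cons, wordProd_cons, Fin.val_zero, List.take_zero, wordProd_nil,
      Fin.val_succ, List.get_cons_zero, one_mul]
    refine Eq.trans ?_ (congrArg (_ + ·) this)
    rw [ P3.mul_j, mink_add_right, mink_Ad_right, inv_inv, hl, P3.j, hl, mink_neg_right,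
      mink_Ad_right, inv_inv]
    ring

lemma startCrossings_l {z y : Word g} (d : Drawing z y) (j : Fin y.length) {q : Crossing}
    (hq : q ∈ d.startCrossings j) : q.l = j := by
  obtain ⟨k, -, hk⟩ := List.mem_filterMap.mp hq
  split_ifs at hk <;> simp_all <;> rw [← hk]

lemma endCrossings_l {z y : Word g} (d : Drawing z y) (j : Fin y.length) {q : Crossing}
    (hq : q ∈ d.endCrossings j) : q.l = j + 1 := by
  obtain ⟨k, -, hk⟩ := List.mem_filterMap.mp hq
  split_ifs at hk <;> simp_all <;> rw [← hk]

lemma mink_list_sum (l : List Crossing) (f : Crossing → Fin 3 → ℝ) (v : Fin 3 → ℝ) :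
    mink (l.map fun q => (q.sign : ℝ) • f q).sum v =
      (l.map fun q => (q.sign : ℝ) * mink (f q) v).sum := by
  induction l with
  | nil => simp [mink_zero_left]
  | cons a l ih => simp [mink_add_left, mink_smul_left, ih]

lemma sum_twistVec_eq_bracketSum {z y : Word g} (d : Drawing z y) (c : Config g)
    (hz : IsHyperbolic (wordProd c z).u) :
    ∑ X, mink (sideSum (lor c) y X (phat (wordProd c y))) (twistVec c z X).2 =
      d.bracketSum c := by
  have hp : Ad (wordProd (lor c) z) (phat (wordProd c z)) = phat (wordProd c z) := by
    rw [← wordProd_lor]; exact Ad_phat hz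
  change ∑ X, mink _ (twistJ (lor c) z (phat (wordProd c z)) X) = _
  rw [← mink_wordProd_ofJ_j, ← neg_neg (mink _ _), neg_mink_wordProd_j, Drawing.bracketSum,
    Drawing.crossings, List.map_flatMap, sum_flatMap, ← Fin.sum_univ_def]
  congr 1
  refine Finset.sum_congr rfl fun j _ => ?_
  simp only [P3.ofJ_u]
  rw [← d.sum_crossings_letter (lor c) _ hp j, mink_add_right]
  -- Crossings before the letter carry its `Ad` on both sides. Splitting it off the prefix shortens
  -- that to `l = j`, while crossings after the letter keep `l = j + 1`.
  nth_rewrite 2 [Drawing.wordProd_take_succ]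
  rw [Ad_mul, mink_Ad_Ad, mink_comm, mink_list_sum, mink_comm, mink_list_sum, List.map_append,
    List.sum_append, add_comm]
  congr 2
  · exact List.map_congr_left fun q hq => by rw [startCrossings_l d j hq]
  · exact List.map_congr_left fun q hq => by rw [endCrossings_l d j hq]

/-- The fundamental formula of Fox calculus, by telescoping. For `p` fixed by the holonomy the sum
vanishes. -/
lemma sum_Ad_sideSum (u : Gen g → L3) (z : Word g) (p : Fin 3 → ℝ) :
    ∑ X, (Ad (u X) (sideSum u z X p) - sideSum u z X p) = Ad (wordProd u z) p - p := by
  induction z generalizing p with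
  | nil => simp [sideSum_nil, Ad_zero, Ad_one]
  | cons l z ih =>
    have h : ∀ X, Ad (u X) (sideSum u (l :: z) X p) - sideSum u (l :: z) X p =
        (if l.1 = X then Ad (letter u l) p - p else 0) +
          (Ad (u X) (sideSum u z X (Ad (letter u l) p)) - sideSum u z X (Ad (letter u l) p)) := by
      intro X
      rw [sideSum_cons, Ad_add]
      by_cases hX : l.1 = X
      · subst hX
        cases hb : l.2 <;> simp [letter, hb, Ad_neg, Ad_Ad_inv] <;> abel
      · simp [hX, Ad_zero]
    simp only [h, Finset.sum_add_distrib, ih, Finset.sum_ite_eq, Finset.mem_univ, if_true,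
      wordProd_cons, Ad_mul]
    abel

/-- For distinct generators the order conditions of the two kernels are complementary, so every term
occurs exactly once. The sum factors as `(Ad(u_X)⁻¹ - 1)(Ad(u_Y) - 1)`. -/
lemma twistKer_add_twistKerAdj (u : Gen g → L3) (X Y : Gen g) (q : Fin 3 → ℝ) :
    twistKer u X Y q + twistKerAdj u Y X q =
      Ad (u X)⁻¹ (Ad (u Y) q) - Ad (u X)⁻¹ q - Ad (u Y) q + q := by
  simp only [twistKer, twistKerAdj, Ad_mul]
  by_cases hXY : X = Y
  · subst hXY
    have h := Drawing.rank_false_lt_true X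
    simp only [le_refl, if_true, h, h.not_gt, lt_irrefl, if_false, Ad_inv_Ad]
    abel
  · have hne : ∀ e e', rank X e ≠ rank Y e' := fun e e' h => hXY (Drawing.rank_injective h).1
    have hle : (rank X true ≤ rank Y true) ↔ rank X true < rank Y true :=
      ⟨fun h => lt_of_le_of_ne h (hne _ _), le_of_lt⟩
    have hle' : (rank Y true ≤ rank X true) ↔ ¬rank X true < rank Y true := by
      rw [not_lt]
    have h2 : ∀ e e', (rank Y e < rank X e') ↔ ¬rank X e' < rank Y e := fun e e' => by
      rw [not_lt]; exact ⟨le_of_lt, fun h => lt_of_le_of_ne h (hne _ _).symm⟩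
    simp only [hle, hle', h2]
    split_ifs <;> simp_all <;> abel

/-- The intersection pairing is antisymmetric on closed curves. -/
lemma twistVec_antisymm (c : Config g) (z y : Word g) (hz : IsHyperbolic (wordProd c z).u) :
    ∑ X, mink (sideSum (lor c) y X (phat (wordProd c y))) (twistVec c z X).2 +
      ∑ X, mink (sideSum (lor c) z X (phat (wordProd c z))) (twistVec c y X).2 = 0 := by
  have hp : Ad (wordProd (lor c) z) (phat (wordProd c z)) = phat (wordProd c z) := by
    rw [← wordProd_lor]; exact Ad_phat hz
  simp only [twistVec, twistJ, mink_sum_right]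
  rw [Finset.sum_comm (f := fun X Y => mink (sideSum (lor c) z X _) _), ← Finset.sum_add_distrib]
  generalize phat (wordProd c y) = p at *
  generalize phat (wordProd c z) = q at *
  have h0 := sum_Ad_sideSum (lor c) z q
  rw [hp, sub_self] at h0
  -- After the kernels are added, the double sum is a product of two Fox sums; that of `z` is zero
  -- since its holonomy fixes `q`.
  calc _ = ∑ X, ∑ Y, mink (Ad (lor c X) (sideSum (lor c) y X p) - sideSum (lor c) y X p)
        (Ad (lor c Y) (sideSum (lor c) z Y q) - sideSum (lor c) z Y q) := by
        refine Finset.sum_congr rfl fun X _ => ?_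
        rw [← Finset.sum_add_distrib]
        refine Finset.sum_congr rfl fun Y _ => ?_
        rw [mink_twistKer (lor c) Y X, ← mink_add_right, twistKer_add_twistKerAdj]
        simp only [mink_add_right, mink_sub_right, mink_sub_left, mink_Ad_left]
        ring
    _ = 0 := by simp only [← mink_sum_right, h0, mink_zero_right, Finset.sum_const_zero]

end symplectic

end Grafting

end

theorem mainTheorem6 {g : ℕ} (x z y : Grafting.Word g)
    (hxz : Grafting.wordProd (Grafting.dualGen FreeGroup.of) x =
      Grafting.wordProd FreeGroup.of z)
    (d : Grafting.Drawing z y) (c : Grafting.Config g)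
    (hhyp : Grafting.IsHyperbolic (Grafting.wordProd c z).u) :
    (∀ (v₀ : Grafting.L3) (w : ℝ),
      Grafting.wordProd (Grafting.graft v₀ x (w * Grafting.mass (Grafting.wordProd c z)) c) y =
          d.graftTilde w c ∧
        (d.graftTilde w c).toDual = d.dehn (w • DualNumber.eps) c) ∧
    (Grafting.IsHyperbolic (Grafting.wordProd c y).u →
      Grafting.HasPoissonBracket (fun c' => Grafting.mass (Grafting.wordProd c' z))
          (fun c' => Grafting.spin (Grafting.wordProd c' y)) c (d.bracketSum c) ∧
        Grafting.HasPoissonBracket (fun c' => Grafting.spin (Grafting.wordProd c' z))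
          (fun c' => Grafting.mass (Grafting.wordProd c' y)) c (d.bracketSum c)) := by
  open Grafting in
  refine ⟨fun v₀ w => ⟨?_, toDual_graftTilde d c w⟩, fun hy => ⟨?_, ?_⟩⟩
  · rw [graft_eq v₀ x z hxz c (mass_pos hhyp).ne', graftTilde_eq d c (Ad_pvec hhyp)]
  · refine ⟨(hasFDerivAt_mass c z hhyp).differentiableAt, differentiableAt_spin c y hy,
      omega_nondegenerate c, twistVec c z, fun ζ => ?_, ?_⟩
    · rw [omega_twistVec c z hhyp, fderiv_mass c z hhyp]
    · rw [fderiv_spin_vertical c y hy _ fun X => rfl, sum_twistVec_eq_bracketSum d c hhyp]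
  -- The Hamiltonian vector of the spin is never computed. Antisymmetry of `Ω` turns `dm_η(V)` into
  -- minus the derivative of `s_λ` along the twist vector of `η`, and antisymmetry of the
  -- intersection pairing gives the stated sum.
  · obtain ⟨V, hV⟩ := exists_hamiltonian c
      (fderiv ℝ ((fun c' => spin (wordProd c' z)) ∘ chart c) 0)
    refine ⟨differentiableAt_spin c z hhyp, (hasFDerivAt_mass c y hy).differentiableAt,
      omega_nondegenerate c, V, hV, ?_⟩
    rw [fderiv_mass c y hy, ← omega_twistVec c y hy, omega_swap, hV,
      fderiv_spin_vertical c z hhyp _ fun X => rfl, ← sum_twistVec_eq_bracketSum d c hhyp]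
    linarith [twistVec_antisymm c z y hhyp]
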